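/- Let $m,N\ge 1$ and let $f:\mathbb R^n\times[0,\infty)\to\mathbb R^n$ be continuous and of class $\mathrm{QUAD}(G,\alpha I_n,\beta)$: for a symmetric positive definite matrix $G$, some $\alpha\in\mathbb R$ and some $\beta>0$, $$(\xi-\zeta)^\top G\,[f(\xi,t)-f(\zeta,t)-\alpha(\xi-\zeta)]\le-\beta\|\xi-\zeta\|^2\qquad\text{for all }\xi,\zeta\in\mathbb R^n,\ t\ge 0.$$ Let $s$ satisfy $\dot s(t)=f(s(t),t)$ for $t\ge 0$. Let $L(1),\dots,L(N)\in\mathbb R^{m\times m}$ have nonnegative off-diagonal entries and zero row sums, and let each $L(i)$ be strongly connected. Let $C(i)=\mathrm{diag}(c_1(i),\dots,c_m(i))$ with $c_j(i)\in\{0,1\}$; if $\alpha\ge 0$, assume that no $C(i)$ is zero. Let $(\sigma_t)_{t\ge 0}$ be a homogeneous continuous-time Markov chain on $\{1,\dots,N\}$ with right-continuous piecewise constant paths and generator $Q=[q_{ij}]$, and put $q_i=-q_{ii}$. For $\kappa,\epsilon>0$ consider the network $$\dot x^j(t)=f(x^j(t),t)+\kappa\sum_{k=1}^m l_{jk}(\sigma_t)\,x^k(t)+\kappa\epsilon\,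 c_j(\sigma_t)\,(s(t)-x^j(t)),\qquad j=1,\dots,m,$$ whose random initial value $x(0)$ is square integrable and independent of $(\sigma_t)$. Solutions have continuous paths and are adapted to the (completed) filtration generated by $x(0)$ and $\sigma$. Write $A^s=(A+A^\top)/2$ and let $\lambda_M$ denote the largest eigenvalue of a symmetric matrix. (i) There exist positive vectors $p^i$ with $(p^i)^\top L(i)=0$, $i=1,\dots,N$, and constants $\kappa,\epsilon>0$ such that, with $P_i=\mathrm{diag}(p^i)$, the matrices $\{P_i[\alpha I_m+\kappa L(i)-\kappa\epsilon C(i)]\}^s$, $i=1,\dots,N$, are all negative definite. (ii) Let $P_1,\dots,P_N$ be positive definite diagonal matrices and $\kappa,\epsilon>0$ constants such that all matrices $\{P_i[\alpha I_m+\kappa L(i)-\kappa\epsilon C(i)]\}^s$ are negative definite. If $$q_i\le-\frac{\lambda_M\big(\{P_i[\alpha I_m+\kappa L(i)-\kappa\epsilon C(i)]\}^s\big)}{\max_j\lambda_M(P_j)}\qquad\text{for all }i,$$ then the network is exponentially stable at $s$ in mean square: there is $\delta>0$ such that for every solution $x$ there is $M>0$ with $\mathbb E\|x^j(t)-s(t)\|^2\le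 Me^{-\delta t}$ for all $t>0$ and $j=1,\dots,m$. -/

import Mathlib

open MeasureTheory ProbabilityTheory Filter Topology Asymptotics
open scoped Matrix NNReal

namespace Pinning

/-! ### Matrices -/

/-- The symmetric part `(A + Aᵀ) / 2` of a square matrix. -/
noncomputable def symPart {m : ℕ} (A : Matrix (Fin m) (Fin m) ℝ) : Matrix (Fin m) (Fin m) ℝ :=
  (1 / 2 : ℝ) • (A + Aᵀ)

/-- A real symmetric matrix is negative definite. -/
def NegDef {m : ℕ} (A : Matrix (Fin m) (Fin m) ℝ) : Prop := (-A).PosDef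

/-- The largest eigenvalue of a (nonempty) real symmetric matrix. -/
noncomputable def lambdaMax {m : ℕ} (A : Matrix (Fin m) (Fin m) ℝ) : ℝ := sSup (spectrum ℝ A)

/-- Coupling matrices: Metzler matrices (nonnegative off the diagonal) with zero row sums. -/
structure IsCoupling {m : ℕ} (L : Matrix (Fin m) (Fin m) ℝ) : Prop where
  offDiag_nonneg : ∀ j k, j ≠ k → 0 ≤ L j k
  row_sum : ∀ j, ∑ k, L j k = 0

/-- The directed graph on the nodes, with an edge between `j` and `k ≠ j` whenever `L j k` is
nonzero, is strongly connected: every node can be reached from every node. -/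
def StronglyConnected {m : ℕ} (L : Matrix (Fin m) (Fin m) ℝ) : Prop :=
  ∀ j k, Relation.ReflTransGen (fun a b => a ≠ b ∧ L a b ≠ 0) j k

/-! ### The function class QUAD -/

/-- The class `QUAD(G, αΓ, β)` of continuous `f : ℝⁿ × [0, ∞) → ℝⁿ` with
`(ξ - ζ)ᵀ G [f(ξ, t) - f(ζ, t) - αΓ(ξ - ζ)] ≤ -β (ξ - ζ)ᵀ(ξ - ζ)`;
here `G` is (symmetric) positive definite and `β > 0`. Values of `f` at negative times are
irrelevant. -/
structure QUAD {n : ℕ} (G : Matrix (Fin n) (Fin n) ℝ) (α : ℝ) (Γ : Matrix (Fin n) (Fin n) ℝ)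
    (β : ℝ) (f : EuclideanSpace ℝ (Fin n) → ℝ → EuclideanSpace ℝ (Fin n)) : Prop where
  posDef : G.PosDef
  beta_pos : 0 < β
  continuousOn : ContinuousOn (fun z : EuclideanSpace ℝ (Fin n) × ℝ => f z.1 z.2)
    (Set.univ ×ˢ Set.Ici 0)
  quad : ∀ t, 0 ≤ t → ∀ ξ ζ : EuclideanSpace ℝ (Fin n),
    (ξ - ζ).ofLp ⬝ᵥ (G *ᵥ ((f ξ t - f ζ t).ofLp - (α • Γ) *ᵥ (ξ - ζ).ofLp)) ≤
      -β * ((ξ - ζ).ofLp ⬝ᵥ (ξ - ζ).ofLp)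

/-! ### Continuous-time Markov chains on a finite state space -/

section Chain

variable {Ω : Type*} {N : ℕ}

/-- The σ-algebra generated by `σ r`, `0 ≤ r ≤ t`. -/
abbrev history (σ : ℝ → Ω → Fin N) (t : ℝ) : MeasurableSpace Ω :=
  ⨆ r ∈ Set.Icc (0 : ℝ) t, MeasurableSpace.comap (σ r) ⊤

/-- `p` is a family of transition matrices (stochastic, satisfying the Chapman-Kolmogorov
equations) with generator `Q`: `p_{ij}(h) = δ_{ij} + q_{ij} h + o(h)` as `h ↓ 0`.
This forces `q_{ij} ≥ 0` for `i ≠ j` and zero row sums of `Q`. -/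
structure IsTransitionFunction (Q : Matrix (Fin N) (Fin N) ℝ)
    (p : ℝ → Matrix (Fin N) (Fin N) ℝ) : Prop where
  nonneg : ∀ h, 0 ≤ h → ∀ i j, 0 ≤ p h i j
  row_sum : ∀ h, 0 ≤ h → ∀ i, ∑ j, p h i j = 1
  zero : p 0 = 1
  chapman_kolmogorov : ∀ h k, 0 ≤ h → 0 ≤ k → p (h + k) = p h * p k
  generator : ∀ i j, (fun h : ℝ => p h i j - (1 : Matrix (Fin N) (Fin N) ℝ) i j - Q i j * h)
    =o[𝓝[>] 0] (fun h : ℝ => h)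

/-- `σ` is a homogeneous continuous-time Markov chain (time `t ≥ 0`) with state space `Fin N`,
generator `Q`, arbitrary initial distribution, and right-continuous piecewise constant paths. -/
structure IsMarkovChain [MeasurableSpace Ω] (μ : Measure Ω) (Q : Matrix (Fin N) (Fin N) ℝ)
    (σ : ℝ → Ω → Fin N) : Prop where
  measurable : ∀ t, 0 ≤ t → Measurable (σ t)
  right_cont : ∀ᵐ ω ∂μ, ∀ t, 0 ≤ t → ∀ᶠ u in 𝓝[>] t, σ u ω = σ t ω
  left_lim : ∀ᵐ ω ∂μ, ∀ t, 0 < t → ∃ i, ∀ᶠ u in 𝓝[<] t, σ u ω = i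
  /-- `P(σ_{t+h} = j | A, σ_t = i) = p_{ij}(h)` for every event `A` of the history up to `t`. -/
  markov : ∃ p, IsTransitionFunction Q p ∧ ∀ t h, 0 ≤ t → 0 ≤ h → ∀ i j, ∀ A : Set Ω,
    MeasurableSet[history σ t] A →
      μ.real (A ∩ σ t ⁻¹' {i} ∩ σ (t + h) ⁻¹' {j}) = μ.real (A ∩ σ t ⁻¹' {i}) * p h i j

end Chain

/-! ### The pinning controlled network -/

section Network

variable {Ω : Type*} {m n N : ℕ}

/-- The right-hand side of the `j`-th node equation when the chain is in state `i`, the nodes are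
in the states `x`, the target is at the point `s` and the time is `t`:
`f(xʲ, t) + κ ∑ₖ l_{jk}(i) Γ xᵏ + κ ε c_j(i) Γ (s - xʲ)`. -/
noncomputable def drift (f : EuclideanSpace ℝ (Fin n) → ℝ → EuclideanSpace ℝ (Fin n))
    (Γ : Matrix (Fin n) (Fin n) ℝ) (κ ε : ℝ) (L : Fin N → Matrix (Fin m) (Fin m) ℝ)
    (c : Fin N → Fin m → ℝ) (i : Fin N) (t : ℝ) (s : EuclideanSpace ℝ (Fin n))
    (x : Fin m → EuclideanSpace ℝ (Fin n)) (j : Fin m) : EuclideanSpace ℝ (Fin n) :=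
  f (x j) t + κ • ∑ k, L i j k • Matrix.toEuclideanLin Γ (x k)
    + (κ * ε * c i j) • Matrix.toEuclideanLin Γ (s - x j)

/-- `x` is a solution process of the network driven by the chain `σ`, with random initial value
`x 0`. Almost every path is continuous and satisfies the differential equation; as the chain jumps,
the derivative is the right derivative (it is the two-sided one wherever the chain is continuous).
As usual, the solution is adapted: up to null sets, `x t` is a function of the initial value and of
the chain up to time `t`. -/
structure IsSolution [MeasurableSpace Ω] (μ : Measure Ω)
    (f : EuclideanSpace ℝ (Fin n) → ℝ → EuclideanSpace ℝ (Fin n))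
    (Γ : Matrix (Fin n) (Fin n) ℝ) (κ ε : ℝ) (L : Fin N → Matrix (Fin m) (Fin m) ℝ)
    (c : Fin N → Fin m → ℝ) (s : ℝ → EuclideanSpace ℝ (Fin n)) (σ : ℝ → Ω → Fin N)
    (x : ℝ → Ω → Fin m → EuclideanSpace ℝ (Fin n)) : Prop where
  measurable_init : Measurable (x 0)
  adapted : ∀ t, 0 ≤ t → AEStronglyMeasurable[
    MeasurableSpace.comap (x 0) inferInstance ⊔ history σ t] (x t) μ
  continuousOn : ∀ᵐ ω ∂μ, ∀ j, ContinuousOn (fun t => x t ω j) (Set.Ici 0)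
  equation : ∀ᵐ ω ∂μ, ∀ t, 0 ≤ t → ∀ j, HasDerivWithinAt (fun u => x u ω j)
    (drift f Γ κ ε L c (σ t ω) t (s t) (x t ω) j) (Set.Ici t) t

/-- The network is exponentially stable at `s` in mean square: there is a rate `δ > 0` such that
every solution `x`, started from a square-integrable random initial value that is independent of
the chain, satisfies `E ‖xʲ(t) - s(t)‖² ≤ M exp(-δ t)` for all `j` and `t > 0`, with some `M`. -/
def MeanSquareExpStable [MeasurableSpace Ω] (μ : Measure Ω)
    (f : EuclideanSpace ℝ (Fin n) → ℝ → EuclideanSpace ℝ (Fin n))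
    (Γ : Matrix (Fin n) (Fin n) ℝ) (κ ε : ℝ) (L : Fin N → Matrix (Fin m) (Fin m) ℝ)
    (c : Fin N → Fin m → ℝ) (s : ℝ → EuclideanSpace ℝ (Fin n)) (σ : ℝ → Ω → Fin N) : Prop :=
  ∃ δ : ℝ, 0 < δ ∧ ∀ x : ℝ → Ω → Fin m → EuclideanSpace ℝ (Fin n),
    IsSolution μ f Γ κ ε L c s σ x →
    IndepFun (x 0) (fun ω (t : ℝ≥0) => σ t ω) μ →
    (∀ j, MemLp (fun ω => x 0 ω j) 2 μ) →
    ∃ M : ℝ, 0 < M ∧ ∀ t, 0 < t → ∀ j,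
      Integrable (fun ω => ‖x t ω j - s t‖ ^ 2) μ ∧
      ∫ ω, ‖x t ω j - s t‖ ^ 2 ∂μ ≤ M * Real.exp (-δ * t)

end Network

/-- The matrix `P [α I + κ L - κ ε C]` with `P = diag p` and `C = diag c`. -/
noncomputable def lyapMatrix {m : ℕ} (α κ ε : ℝ) (L : Matrix (Fin m) (Fin m) ℝ)
    (c p : Fin m → ℝ) : Matrix (Fin m) (Fin m) ℝ :=
  Matrix.diagonal p *
    (α • (1 : Matrix (Fin m) (Fin m) ℝ) + κ • L - (κ * ε) • Matrix.diagonal c)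

end Pinning

/-!
# Pinning synchronization of networks with Markovian switching topology

*Feasibility of the matrix inequalities.* A strongly connected coupling matrix `L` is singular, and
if `v` is a left null vector then so is `|v|`, because `|v| L` is nonnegative with entries summing to
zero; strong connectivity makes `|v|` positive (`IsCoupling.exists_pos_vecMul_eq_zero`). With
`P = diag p` for this vector, `xᵀ P L x = -(1/2) ∑ p_j l_jk (x_j - x_k)²`, so the form of `P (L - C)`
is negative definite as soon as one node is pinned, and a large `κ` absorbs `α P`
(`exists_negDef_lyapMatrix`).

*Mean-square stability.* Let `e_k = x_k - s` and `V_i = ∑ p^i_k e_kᵀ G e_k`. Along a path with the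
chain in the mode `i`, the QUAD condition and the Rayleigh bound for `P_i (α I + κ L(i) - κ ε C(i))`
give `V_i' ≤ B_i := 2 λ_i ∑ e_kᵀ G e_k - 2 β ∑ p^i_k ‖e_k‖²`
(`exists_hasDerivWithinAt_energy_path`), where `λ_i` is the largest eigenvalue of the symmetric part.
The jumps of the chain add at most `q_i max_j λ_M(P_j) ∑ e_kᵀ G e_k`, and by the assumption on `q_i`
this is absorbed by `λ_i`, so that `B_i + ∑_j q_ij V_j ≤ -δ V_i` with `δ = 2 β / g`, where
`e_kᵀ G e_k ≤ g ‖e_k‖²` (`dissipation_add_generator_le`).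

Put `φ(t) = E V_{σ_t}(t)`. The increment `φ(t + h) - φ(t)` splits into the motion of the nodes with
the chain at `σ_{t+h}`, and the jump of the chain with the nodes frozen at time `t`. The first part
is treated by dominated convergence (`eventually_integral_energy_increment_le`). The second is exactly
`∑ (p_ij(h) - δ_ij) E[V_j(t) 1{σ_t = i}]`, by the Markov property; as the solution is adapted to the
initial value and the chain, and these are independent, that property extends to functionals of the
solution (`setIntegral_inter_eq_mul`). Hence the upper right Dini derivative of `φ` is at most
`-δ φ`. As `f` is only one-sided Lipschitz, increments of the energy are bounded from above only, but
this excludes upward jumps of `φ`, which suffices for exponential decay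
(`le_mul_exp_of_forall_eventually`).
-/

namespace Pinning

/-! ### Quadratic forms of symmetric matrices -/

lemma symPart_isHermitian {m : ℕ} (A : Matrix (Fin m) (Fin m) ℝ) : (symPart A).IsHermitian := by
  unfold symPart Matrix.IsHermitian
  rw [Matrix.conjTranspose_eq_transpose_of_trivial, Matrix.transpose_smul, Matrix.transpose_add,
    Matrix.transpose_transpose, add_comm]

lemma dotProduct_transpose_mulVec {m : ℕ} (A : Matrix (Fin m) (Fin m) ℝ) (x y : Fin m → ℝ) :
    x ⬝ᵥ (Aᵀ *ᵥ y) = y ⬝ᵥ (A *ᵥ x) := by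
  rw [Matrix.mulVec_transpose, dotProduct_comm, Matrix.dotProduct_mulVec]

lemma dotProduct_symPart_mulVec {m : ℕ} (A : Matrix (Fin m) (Fin m) ℝ) (x : Fin m → ℝ) :
    x ⬝ᵥ (symPart A *ᵥ x) = x ⬝ᵥ (A *ᵥ x) := by
  unfold symPart
  rw [Matrix.smul_mulVec, Matrix.add_mulVec, dotProduct_smul, dotProduct_add,
    dotProduct_transpose_mulVec, smul_eq_mul]
  ring

open scoped MatrixOrder in
/-- The Rayleigh bound `xᵀ A x ≤ λ_M(A) ‖x‖²`. -/
lemma dotProduct_mulVec_le_lambdaMax {m : ℕ} {A : Matrix (Fin m) (Fin m) ℝ}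
    (hA : A.IsHermitian) (x : Fin m → ℝ) : x ⬝ᵥ (A *ᵥ x) ≤ lambdaMax A * (x ⬝ᵥ x) := by
  have h : A ≤ algebraMap ℝ _ (lambdaMax A) :=
    (le_algebraMap_iff_spectrum_le (ha := hA.isSelfAdjoint)).2 fun r hr =>
      le_csSup (Matrix.finite_real_spectrum (A := A)).bddAbove hr
  have h2 := (Matrix.le_iff.1 h).dotProduct_mulVec_nonneg x
  rw [Matrix.sub_mulVec, dotProduct_sub, Algebra.algebraMap_eq_smul_one, Matrix.smul_mulVec,
    Matrix.one_mulVec, dotProduct_smul] at h2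
  simpa using h2

lemma dotProduct_mulVec_le_lambdaMax_symPart {m : ℕ} (A : Matrix (Fin m) (Fin m) ℝ)
    (x : Fin m → ℝ) : x ⬝ᵥ (A *ᵥ x) ≤ lambdaMax (symPart A) * (x ⬝ᵥ x) := by
  rw [← dotProduct_symPart_mulVec]
  exact dotProduct_mulVec_le_lambdaMax (symPart_isHermitian A) x

open scoped MatrixOrder in
/-- A positive definite matrix dominates a positive multiple of the identity. -/
lemma exists_pos_le_dotProduct_mulVec {m : ℕ} {A : Matrix (Fin m) (Fin m) ℝ} (hA : A.PosDef) :
    ∃ g : ℝ, 0 < g ∧ ∀ x : Fin m → ℝ, g * (x ⬝ᵥ x) ≤ x ⬝ᵥ (A *ᵥ x) := by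
  obtain ⟨g, hg, hle⟩ : ∃ g : ℝ, 0 < g ∧ ∀ i, g ≤ hA.1.eigenvalues i := by
    rcases isEmpty_or_nonempty (Fin m) with h | h
    · exact ⟨1, one_pos, fun i => h.elim i⟩
    · obtain ⟨i, hi⟩ := Finite.exists_min hA.1.eigenvalues
      exact ⟨_, hA.eigenvalues_pos i, hi⟩
  refine ⟨g, hg, fun x => ?_⟩
  have h : algebraMap ℝ _ g ≤ A :=
    (algebraMap_le_iff_le_spectrum (ha := hA.1.isSelfAdjoint)).2 fun r hr => by
      rw [hA.1.spectrum_real_eq_range_eigenvalues] at hr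
      obtain ⟨i, rfl⟩ := hr
      exact hle i
  have h2 := (Matrix.le_iff.1 h).dotProduct_mulVec_nonneg x
  rw [Matrix.sub_mulVec, dotProduct_sub, Algebra.algebraMap_eq_smul_one, Matrix.smul_mulVec,
    Matrix.one_mulVec, dotProduct_smul] at h2
  simpa using h2

lemma le_lambdaMax_diagonal {m : ℕ} (p : Fin m → ℝ) (k : Fin m) :
    p k ≤ lambdaMax (Matrix.diagonal p) :=
  le_csSup (Matrix.finite_real_spectrum (A := Matrix.diagonal p)).bddAbove (by simp)

open scoped MatrixOrder in
/-- The bound `∑ A_{jk} e_jᵀ G e_k ≤ λ_M(Aˢ) ∑ e_kᵀ G e_k`, that is,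
`A ⊗ G ≤ λ_M(Aˢ) (I ⊗ G)` as quadratic forms. Writing `G = Bᵀ B`, it is the Rayleigh bound for `A`
in each coordinate of the vectors `B e_k`. -/
lemma sum_mul_dotProduct_mulVec_le {m n : ℕ} {G : Matrix (Fin n) (Fin n) ℝ} (hG : G.PosDef)
    (A : Matrix (Fin m) (Fin m) ℝ) (e : Fin m → Fin n → ℝ) :
    ∑ j, ∑ k, A j k * (e j ⬝ᵥ (G *ᵥ e k)) ≤
      lambdaMax (symPart A) * ∑ k, e k ⬝ᵥ (G *ᵥ e k) := by
  obtain ⟨B, hB⟩ := CStarAlgebra.nonneg_iff_eq_star_mul_self.1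
    (Matrix.nonneg_iff_posSemidef.2 hG.posSemidef)
  have hG' : ∀ u v : Fin n → ℝ, u ⬝ᵥ (G *ᵥ v) = ∑ l, (B *ᵥ u) l * (B *ᵥ v) l := by
    intro u v
    rw [hB, ← Matrix.mulVec_mulVec, Matrix.star_eq_conjTranspose,
      Matrix.conjTranspose_eq_transpose_of_trivial, dotProduct_transpose_mulVec, dotProduct_comm]
    rfl
  have h := Finset.sum_le_sum fun l (_ : l ∈ Finset.univ) =>
    dotProduct_mulVec_le_lambdaMax_symPart A (fun k => (B *ᵥ e k) l)
  simp only [hG']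
  rw [← Finset.mul_sum] at h
  refine (le_of_eq ?_).trans (h.trans_eq ?_)
  · simp only [dotProduct, Matrix.mulVec, Finset.mul_sum]
    conv_rhs => rw [Finset.sum_comm]
    refine Finset.sum_congr rfl fun j _ => ?_
    rw [Finset.sum_comm]
    exact Finset.sum_congr rfl fun l _ => Finset.sum_congr rfl fun k _ =>
      Finset.sum_congr rfl fun _ _ => mul_left_comm _ _ _
  · congr 1
    rw [Finset.sum_comm]
    rfl

/-! ### Strongly connected coupling matrices -/

namespace IsCoupling

variable {m : ℕ} {L : Matrix (Fin m) (Fin m) ℝ}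

/-- If `v` is a left null vector then so is `|v|`: the vector `|v| L` is nonnegative, since
`|v_k| |l_kk| ≤ ∑_{j ≠ k} |v_j| l_jk`, and its entries sum to zero as the row sums of `L` vanish. -/
lemma abs_vecMul_eq_zero (hL : IsCoupling L) {v : Fin m → ℝ} (hv : v ᵥ* L = 0) :
    (fun j => |v j|) ᵥ* L = 0 := by
  have hnn : ∀ k, 0 ≤ ((fun j => |v j|) ᵥ* L) k := by
    intro k
    have hk : ∑ j, v j * L j k = 0 := congrFun hv k
    change 0 ≤ ∑ j, |v j| * L j k
    rw [← Finset.add_sum_erase _ _ (Finset.mem_univ k)] at hk ⊢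
    have h1 : |v k * L k k| ≤ ∑ j ∈ Finset.univ.erase k, |v j| * L j k := by
      rw [eq_neg_of_add_eq_zero_left hk, abs_neg]
      refine (Finset.abs_sum_le_sum_abs _ _).trans (Finset.sum_le_sum fun j hj => ?_)
      rw [abs_mul, abs_of_nonneg (hL.offDiag_nonneg j k (Finset.ne_of_mem_erase hj))]
    have h2 : -|L k k| ≤ L k k := neg_abs_le _
    rw [abs_mul] at h1
    nlinarith [abs_nonneg (v k)]
  have hsum : ∑ k, ((fun j => |v j|) ᵥ* L) k = 0 := by
    change ∑ k, ∑ j, |v j| * L j k = 0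
    rw [Finset.sum_comm]
    simp [← Finset.mul_sum, hL.row_sum]
  funext k
  exact (Finset.sum_eq_zero_iff_of_nonneg fun k _ => hnn k).1 hsum k (Finset.mem_univ k)

/-- A strongly connected coupling matrix has a positive left null vector (the Perron vector). -/
lemma exists_pos_vecMul_eq_zero (hL : IsCoupling L) (hc : StronglyConnected L) (hm : 0 < m) :
    ∃ p : Fin m → ℝ, (∀ j, 0 < p j) ∧ p ᵥ* L = 0 := by
  have : Nonempty (Fin m) := ⟨⟨0, hm⟩⟩
  have hdet : L.det = 0 := Matrix.exists_mulVec_eq_zero_iff.1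
    ⟨fun _ => 1, fun h => one_ne_zero (congrFun h ⟨0, hm⟩), by
      funext j
      simpa [Matrix.mulVec, dotProduct] using hL.row_sum j⟩
  obtain ⟨v, hv0, hv⟩ := Matrix.exists_vecMul_eq_zero_iff.2 hdet
  have hp := hL.abs_vecMul_eq_zero hv
  refine ⟨fun j => |v j|, fun k => abs_pos.2 fun hk => hv0 ?_, hp⟩
  -- zeros of `v` propagate backwards along the edges
  have hstep : ∀ j k, j ≠ k ∧ L j k ≠ 0 → v k = 0 → v j = 0 := by
    rintro j k ⟨hjk, hLjk⟩ hk
    have h := congrFun hp k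
    change ∑ j, |v j| * L j k = 0 at h
    rw [Finset.sum_eq_zero_iff_of_nonneg] at h
    · simpa [hLjk] using h j (Finset.mem_univ j)
    · intro i _
      rcases eq_or_ne i k with rfl | hik
      · simp [hk]
      · exact mul_nonneg (abs_nonneg _) (hL.offDiag_nonneg i k hik)
  funext j
  have hjk := hc j k
  induction hjk using Relation.ReflTransGen.head_induction_on with
  | refl => exact hk
  | head h _ ih => exact hstep _ _ h ih

/-- The Dirichlet form of a coupling matrix with left null vector `p`. -/
lemma dotProduct_diagonal_mul_mulVec (hL : IsCoupling L) {p : Fin m → ℝ} (hp : p ᵥ* L = 0)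
    (x : Fin m → ℝ) : x ⬝ᵥ ((Matrix.diagonal p * L) *ᵥ x) =
      -(1 / 2) * ∑ j, ∑ k, p j * L j k * (x j - x k) ^ 2 := by
  have h1 : ∑ j, ∑ k, p j * L j k * x j ^ 2 = 0 := by
    refine Finset.sum_eq_zero fun j _ => ?_
    rw [← Finset.sum_mul, ← Finset.mul_sum, hL.row_sum]; simp
  have h2 : ∑ j, ∑ k, p j * L j k * x k ^ 2 = 0 := by
    rw [Finset.sum_comm]
    refine Finset.sum_eq_zero fun k _ => ?_
    have : ∑ j, p j * L j k = 0 := congrFun hp k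
    rw [← Finset.sum_mul, this, zero_mul]
  have h3 : ∑ j, ∑ k, p j * L j k * (x j - x k) ^ 2 =
      ∑ j, ∑ k, p j * L j k * x j ^ 2 + ∑ j, ∑ k, p j * L j k * x k ^ 2
        - 2 * ∑ j, ∑ k, x j * (p j * L j k * x k) := by
    simp only [Finset.mul_sum, ← Finset.sum_add_distrib, ← Finset.sum_sub_distrib]
    exact Finset.sum_congr rfl fun j _ => Finset.sum_congr rfl fun k _ => by ring
  have h4 : x ⬝ᵥ ((Matrix.diagonal p * L) *ᵥ x) = ∑ j, ∑ k, x j * (p j * L j k * x k) := by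
    simp only [dotProduct, Matrix.mulVec, Matrix.diagonal_mul, Finset.mul_sum]
  rw [h3, h1, h2, h4]
  ring

end IsCoupling

lemma dotProduct_lyapMatrix_mulVec {m : ℕ} (α κ ε : ℝ) (L : Matrix (Fin m) (Fin m) ℝ)
    (c p x : Fin m → ℝ) : x ⬝ᵥ (lyapMatrix α κ ε L c p *ᵥ x) =
      α * ∑ j, p j * x j ^ 2 + κ * (x ⬝ᵥ ((Matrix.diagonal p * L) *ᵥ x)
        - ε * ∑ j, p j * c j * x j ^ 2) := by
  unfold lyapMatrix
  simp only [Matrix.mul_sub, Matrix.mul_add, Matrix.mul_smul, Matrix.sub_mulVec, Matrix.add_mulVec,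
    Matrix.smul_mulVec, dotProduct_add, dotProduct_sub, dotProduct_smul, Matrix.mul_one,
    Matrix.diagonal_mul_diagonal, smul_eq_mul]
  simp only [Matrix.mulVec_diagonal, dotProduct]
  have h1 : ∑ j, x j * (p j * x j) = ∑ j, p j * x j ^ 2 :=
    Finset.sum_congr rfl fun j _ => by ring
  have h2 : ∑ j, x j * (p j * c j * x j) = ∑ j, p j * c j * x j ^ 2 :=
    Finset.sum_congr rfl fun j _ => by ring
  rw [h1, h2]
  ring

lemma negDef_symPart_of_neg {m : ℕ} {A : Matrix (Fin m) (Fin m) ℝ}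
    (h : ∀ x, x ≠ 0 → x ⬝ᵥ (A *ᵥ x) < 0) : NegDef (symPart A) := by
  refine Matrix.PosDef.of_dotProduct_mulVec_pos (symPart_isHermitian A).neg fun {x} hx => ?_
  rw [star_trivial, Matrix.neg_mulVec, dotProduct_neg, dotProduct_symPart_mulVec]
  exact neg_pos.2 (h x hx)

/-- The form of `P (L - C)` is nonpositive, and negative off zero if `L` is strongly connected and at
least one node is pinned: it vanishes only on vectors that are constant along edges and zero at the pinned nodes. -/
lemma dirichlet_sub_pinning_nonpos {m : ℕ} {L : Matrix (Fin m) (Fin m) ℝ} (hL : IsCoupling L)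
    {p c : Fin m → ℝ} (hp : ∀ j, 0 < p j) (hpL : p ᵥ* L = 0) (hc : ∀ j, 0 ≤ c j)
    (x : Fin m → ℝ) :
    x ⬝ᵥ ((Matrix.diagonal p * L) *ᵥ x) - ∑ j, p j * c j * x j ^ 2 ≤ 0 ∧
    (StronglyConnected L → (∃ j, 0 < c j) → x ≠ 0 →
      x ⬝ᵥ ((Matrix.diagonal p * L) *ᵥ x) - ∑ j, p j * c j * x j ^ 2 < 0) := by
  rw [hL.dotProduct_diagonal_mul_mulVec hpL]
  have t1 : ∀ j k, 0 ≤ p j * L j k * (x j - x k) ^ 2 := by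
    intro j k
    rcases eq_or_ne j k with rfl | hjk
    · simp
    · exact mul_nonneg (mul_nonneg (hp j).le (hL.offDiag_nonneg j k hjk)) (sq_nonneg _)
  have t2 : ∀ j, 0 ≤ p j * c j * x j ^ 2 := fun j =>
    mul_nonneg (mul_nonneg (hp j).le (hc j)) (sq_nonneg _)
  have s1 : 0 ≤ ∑ j, ∑ k, p j * L j k * (x j - x k) ^ 2 :=
    Finset.sum_nonneg fun j _ => Finset.sum_nonneg fun k _ => t1 j k
  have s2 : 0 ≤ ∑ j, p j * c j * x j ^ 2 := Finset.sum_nonneg fun j _ => t2 j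
  refine ⟨by linarith, fun hconn ⟨j₀, hj₀⟩ hx => ?_⟩
  by_contra! hcon
  have e1 : ∑ j, ∑ k, p j * L j k * (x j - x k) ^ 2 = 0 := by linarith
  have e2 : ∑ j, p j * c j * x j ^ 2 = 0 := by linarith
  have hx0 : x j₀ = 0 := by
    have := (Finset.sum_eq_zero_iff_of_nonneg fun j _ => t2 j).1 e2 j₀ (Finset.mem_univ _)
    simpa [(hp j₀).ne', hj₀.ne'] using this
  have hstep : ∀ j k, j ≠ k ∧ L j k ≠ 0 → x j = x k := by
    rintro j k ⟨-, hjk⟩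
    have h := (Finset.sum_eq_zero_iff_of_nonneg fun j _ =>
      Finset.sum_nonneg fun k _ => t1 j k).1 e1 j (Finset.mem_univ _)
    have h := (Finset.sum_eq_zero_iff_of_nonneg fun k _ => t1 j k).1 h k (Finset.mem_univ _)
    simpa [(hp j).ne', hjk, sub_eq_zero] using h
  refine hx (funext fun j => ?_)
  rw [Pi.zero_apply]
  have hj := hconn j j₀
  induction hj using Relation.ReflTransGen.head_induction_on with
  | refl => exact hx0
  | head h _ ih => rw [hstep _ _ h, ih]

/-- Feasibility of the matrix inequalities. For `α < 0` the coupling only helps. For `α ≥ 0` the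
form of `P_i (L(i) - C(i))` is uniformly negative definite, so a large `κ` dominates `α P_i`. -/
theorem exists_negDef_lyapMatrix {m N : ℕ} (hm : 0 < m) (α : ℝ)
    (L : Fin N → Matrix (Fin m) (Fin m) ℝ) (hL : ∀ i, IsCoupling (L i))
    (hLconn : ∀ i, StronglyConnected (L i))
    (c : Fin N → Fin m → ℝ) (hc : ∀ i j, c i j = 0 ∨ c i j = 1)
    (hcne : 0 ≤ α → ∀ i, ∃ j, c i j = 1) :
    ∃ p : Fin N → Fin m → ℝ, (∀ i j, 0 < p i j) ∧ (∀ i, p i ᵥ* L i = 0) ∧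
      ∃ κ ε : ℝ, 0 < κ ∧ 0 < ε ∧
        ∀ i, NegDef (symPart (lyapMatrix α κ ε (L i) (c i) (p i))) := by
  choose p hp hpL using fun i => (hL i).exists_pos_vecMul_eq_zero (hLconn i) hm
  have hc0 : ∀ i j, 0 ≤ c i j := fun i j => by rcases hc i j with h | h <;> simp [h]
  refine ⟨p, hp, hpL, ?_⟩
  have hpos : ∀ i (x : Fin m → ℝ), x ≠ 0 → 0 < ∑ j, p i j * x j ^ 2 := fun i x hx => by
    obtain ⟨j, hj⟩ := Function.ne_iff.1 hx
    exact Finset.sum_pos' (fun j _ => mul_nonneg (hp i j).le (sq_nonneg _))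
      ⟨j, Finset.mem_univ j, mul_pos (hp i j) (sq_pos_of_ne_zero hj)⟩
  rcases lt_or_ge α 0 with hα | hα
  · refine ⟨1, 1, one_pos, one_pos, fun i => negDef_symPart_of_neg fun x hx => ?_⟩
    rw [dotProduct_lyapMatrix_mulVec]
    have h1 := (dirichlet_sub_pinning_nonpos (hL i) (hp i) (hpL i) (hc0 i) x).1
    nlinarith [hpos i x hx]
  · have hneg : ∀ i, ∃ g : ℝ, 0 < g ∧ ∀ x : Fin m → ℝ,
        x ⬝ᵥ ((Matrix.diagonal (p i) * L i) *ᵥ x) - ∑ j, p i j * c i j * x j ^ 2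
          ≤ -(g * ∑ j, p i j * x j ^ 2) := by
      intro i
      have hform : ∀ x : Fin m → ℝ, x ⬝ᵥ (lyapMatrix 0 1 1 (L i) (c i) (p i) *ᵥ x) =
          x ⬝ᵥ ((Matrix.diagonal (p i) * L i) *ᵥ x) - ∑ j, p i j * c i j * x j ^ 2 := fun x => by
        rw [dotProduct_lyapMatrix_mulVec]; ring
      have hnd : NegDef (symPart (lyapMatrix 0 1 1 (L i) (c i) (p i))) :=
        negDef_symPart_of_neg fun x hx => by
          rw [hform]
          obtain ⟨j, hj⟩ := hcne hα i
          exact (dirichlet_sub_pinning_nonpos (hL i) (hp i) (hpL i) (hc0 i) x).2 (hLconn i)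
            ⟨j, by simp [hj]⟩ hx
      obtain ⟨g, hg, hgle⟩ := exists_pos_le_dotProduct_mulVec hnd
      have hM : 0 < ∑ j, p i j := Finset.sum_pos (fun j _ => hp i j) ⟨⟨0, hm⟩, Finset.mem_univ _⟩
      refine ⟨g / ∑ j, p i j, div_pos hg hM, fun x => ?_⟩
      have h1 := hgle x
      rw [Matrix.neg_mulVec, dotProduct_neg, dotProduct_symPart_mulVec, hform] at h1
      have h2 : ∑ j, p i j * x j ^ 2 ≤ (∑ j, p i j) * (x ⬝ᵥ x) := by
        rw [dotProduct, Finset.mul_sum]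
        refine Finset.sum_le_sum fun j _ => ?_
        rw [← sq]
        exact mul_le_mul_of_nonneg_right
          (Finset.single_le_sum (fun k _ => (hp i k).le) (Finset.mem_univ j)) (sq_nonneg _)
      have h3 : g / (∑ j, p i j) * ∑ j, p i j * x j ^ 2 ≤ g * (x ⬝ᵥ x) := by
        rw [div_mul_eq_mul_div, div_le_iff₀ hM]
        nlinarith
      linarith
    choose g hg hgle using hneg
    have hS : ∀ i, (α + 1) / g i ≤ ∑ i, (α + 1) / g i := fun i =>
      Finset.single_le_sum (f := fun i => (α + 1) / g i)
        (fun k _ => (div_pos (by linarith) (hg k)).le) (Finset.mem_univ i)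
    have hS0 : 0 ≤ ∑ i, (α + 1) / g i :=
      Finset.sum_nonneg fun k _ => (div_pos (by linarith) (hg k)).le
    refine ⟨∑ i, (α + 1) / g i + 1, 1, by linarith, one_pos,
      fun i => negDef_symPart_of_neg fun x hx => ?_⟩
    rw [dotProduct_lyapMatrix_mulVec, one_mul]
    have h1 := hpos i x hx
    have h2 := mul_le_mul_of_nonneg_left (hgle i x) (by linarith : 0 ≤ ∑ i, (α + 1) / g i + 1)
    have h3 : α + 1 ≤ (∑ i, (α + 1) / g i + 1) * g i := by
      rw [← div_le_iff₀ (hg i)]; linarith [hS i]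
    nlinarith

/-! ### The energy of the synchronization error along a path -/

section Energy

variable {m n : ℕ}

/-- The Lyapunov function `∑ w_k e_kᵀ G e_k` of the errors `e_k`, with node weights `w`. -/
noncomputable def energy (G : Matrix (Fin n) (Fin n) ℝ) (w : Fin m → ℝ)
    (e : Fin m → EuclideanSpace ℝ (Fin n)) : ℝ :=
  ∑ k, w k * ((e k).ofLp ⬝ᵥ (G *ᵥ (e k).ofLp))

lemma quadForm_nonneg {G : Matrix (Fin n) (Fin n) ℝ} (hG : G.PosDef) (v : Fin n → ℝ) :
    0 ≤ v ⬝ᵥ (G *ᵥ v) := by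
  simpa using hG.posSemidef.dotProduct_mulVec_nonneg v

lemma ofLp_dotProduct_self (v : EuclideanSpace ℝ (Fin n)) : v.ofLp ⬝ᵥ v.ofLp = ‖v‖ ^ 2 := by
  rw [EuclideanSpace.real_norm_sq_eq, dotProduct]
  exact Finset.sum_congr rfl fun i _ => (sq _).symm

lemma energy_nonneg {G : Matrix (Fin n) (Fin n) ℝ} (hG : G.PosDef) {w : Fin m → ℝ}
    (hw : ∀ k, 0 ≤ w k) (e : Fin m → EuclideanSpace ℝ (Fin n)) : 0 ≤ energy G w e :=
  Finset.sum_nonneg fun k _ => mul_nonneg (hw k) (quadForm_nonneg hG _)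

lemma energy_le_mul_energy_one {G : Matrix (Fin n) (Fin n) ℝ} (hG : G.PosDef) {w : Fin m → ℝ}
    {W : ℝ} (hw : ∀ k, w k ≤ W) (e : Fin m → EuclideanSpace ℝ (Fin n)) :
    energy G w e ≤ W * energy G 1 e := by
  unfold energy
  rw [Finset.mul_sum]
  refine Finset.sum_le_sum fun k _ => ?_
  rw [Pi.one_apply, one_mul]
  exact mul_le_mul_of_nonneg_right (hw k) (quadForm_nonneg hG _)

lemma mul_energy_one_le_energy {G : Matrix (Fin n) (Fin n) ℝ} (hG : G.PosDef) {w : Fin m → ℝ}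
    {W : ℝ} (hw : ∀ k, W ≤ w k) (e : Fin m → EuclideanSpace ℝ (Fin n)) :
    W * energy G 1 e ≤ energy G w e := by
  unfold energy
  rw [Finset.mul_sum]
  refine Finset.sum_le_sum fun k _ => ?_
  rw [Pi.one_apply, one_mul]
  exact mul_le_mul_of_nonneg_right (hw k) (quadForm_nonneg hG _)

lemma exists_energy_le {G : Matrix (Fin n) (Fin n) ℝ} (hG : G.PosDef) :
    ∃ g : ℝ, 0 < g ∧ ∀ (w : Fin m → ℝ), (∀ k, 0 ≤ w k) → ∀ e : Fin m → EuclideanSpace ℝ (Fin n),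
      energy G w e ≤ g * ∑ k, w k * ‖e k‖ ^ 2 := by
  refine ⟨|lambdaMax G| + 1, by positivity, fun w hw e => ?_⟩
  unfold energy
  rw [Finset.mul_sum]
  refine Finset.sum_le_sum fun k _ => ?_
  have h := dotProduct_mulVec_le_lambdaMax hG.1 (e k).ofLp
  rw [ofLp_dotProduct_self] at h
  have h2 : lambdaMax G * ‖e k‖ ^ 2 ≤ (|lambdaMax G| + 1) * ‖e k‖ ^ 2 :=
    mul_le_mul_of_nonneg_right ((le_abs_self _).trans (by linarith)) (sq_nonneg _)
  nlinarith [mul_le_mul_of_nonneg_left (h.trans h2) (hw k)]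

lemma exists_le_energy {G : Matrix (Fin n) (Fin n) ℝ} (hG : G.PosDef) :
    ∃ g : ℝ, 0 < g ∧ ∀ (e : Fin m → EuclideanSpace ℝ (Fin n)) (k : Fin m),
      g * ‖e k‖ ^ 2 ≤ energy G 1 e := by
  obtain ⟨g, hg, hle⟩ := exists_pos_le_dotProduct_mulVec hG
  refine ⟨g, hg, fun e k => ?_⟩
  have h := hle (e k).ofLp
  rw [ofLp_dotProduct_self] at h
  refine h.trans ?_
  have := Finset.single_le_sum (f := fun k => (1 : Fin m → ℝ) k * ((e k).ofLp ⬝ᵥ (G *ᵥ (e k).ofLp)))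
    (fun k _ => mul_nonneg zero_le_one (quadForm_nonneg hG _)) (Finset.mem_univ k)
  simpa [energy] using this

lemma continuous_energy (G : Matrix (Fin n) (Fin n) ℝ) (w : Fin m → ℝ) :
    Continuous (energy G w) := by
  unfold energy
  simp only [dotProduct, Matrix.mulVec]
  fun_prop

lemma hasDerivWithinAt_energy {G : Matrix (Fin n) (Fin n) ℝ} (hG : G.PosDef) (w : Fin m → ℝ)
    {e : ℝ → Fin m → EuclideanSpace ℝ (Fin n)} {e' : Fin m → EuclideanSpace ℝ (Fin n)} {S : Set ℝ}
    {t : ℝ} (h : ∀ k, HasDerivWithinAt (fun u => e u k) (e' k) S t) :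
    HasDerivWithinAt (fun u => energy G w (e u))
      (2 * ∑ k, w k * ((e t k).ofLp ⬝ᵥ (G *ᵥ (e' k).ofLp))) S t := by
  have hcoord : ∀ k l, HasDerivWithinAt (fun u => (e u k).ofLp l) ((e' k).ofLp l) S t :=
    fun k l =>
      ((EuclideanSpace.proj (𝕜 := ℝ) l).hasFDerivAt.comp_hasDerivWithinAt t (h k))
  have hGT : Gᵀ = G := by
    simpa [Matrix.IsHermitian, Matrix.conjTranspose_eq_transpose_of_trivial] using hG.1
  have hk : ∀ k, HasDerivWithinAt (fun u => (e u k).ofLp ⬝ᵥ (G *ᵥ (e u k).ofLp))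
      (2 * ((e t k).ofLp ⬝ᵥ (G *ᵥ (e' k).ofLp))) S t := by
    intro k
    have h1 : HasDerivWithinAt (fun u => (e u k).ofLp ⬝ᵥ (G *ᵥ (e u k).ofLp))
        (∑ l, ((e' k).ofLp l * (G *ᵥ (e t k).ofLp) l +
          (e t k).ofLp l * (G *ᵥ (e' k).ofLp) l)) S t := by
      refine HasDerivWithinAt.fun_sum fun l _ => (hcoord k l).mul ?_
      simp only [Matrix.mulVec, dotProduct]
      exact HasDerivWithinAt.fun_sum fun r _ => (hcoord k r).const_mul _
    refine h1.congr_deriv ?_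
    rw [Finset.sum_add_distrib]
    have : (e' k).ofLp ⬝ᵥ (G *ᵥ (e t k).ofLp) = (e t k).ofLp ⬝ᵥ (G *ᵥ (e' k).ofLp) := by
      conv_lhs => rw [← hGT]
      exact dotProduct_transpose_mulVec G _ _
    change (e' k).ofLp ⬝ᵥ (G *ᵥ (e t k).ofLp) + (e t k).ofLp ⬝ᵥ (G *ᵥ (e' k).ofLp) = _
    rw [this]; ring
  have := HasDerivWithinAt.fun_sum (u := Finset.univ) fun k _ => (hk k).const_mul (w k)
  refine this.congr_deriv ?_
  rw [Finset.mul_sum]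
  exact Finset.sum_congr rfl fun k _ => by ring

/-- The dissipation inequality. The node dynamics contribute `α e - β ‖e‖²` by the QUAD condition;
since the rows of `L` sum to zero, the rest is a bilinear form in the errors with matrix
`P (α I + κ L - κ ε C)`, bounded by the largest eigenvalue of its symmetric part. -/
lemma sum_dotProduct_drift_le {N : ℕ} {f : EuclideanSpace ℝ (Fin n) → ℝ → EuclideanSpace ℝ (Fin n)}
    {G : Matrix (Fin n) (Fin n) ℝ} {α β : ℝ} (hf : QUAD G α 1 β f)
    {L : Fin N → Matrix (Fin m) (Fin m) ℝ} (hL : ∀ i, IsCoupling (L i)) (c : Fin N → Fin m → ℝ)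
    (κ ε : ℝ) {w : Fin m → ℝ} (hw : ∀ k, 0 ≤ w k) (i : Fin N) {t : ℝ} (ht : 0 ≤ t)
    (s : EuclideanSpace ℝ (Fin n)) (x : Fin m → EuclideanSpace ℝ (Fin n)) :
    2 * ∑ k, w k * ((x k - s).ofLp ⬝ᵥ (G *ᵥ (drift f 1 κ ε L c i t s x k - f s t).ofLp)) ≤
      2 * lambdaMax (symPart (lyapMatrix α κ ε (L i) (c i) w)) * energy G 1 (fun k => x k - s)
        - 2 * β * ∑ k, w k * ‖x k - s‖ ^ 2 := by
  have hsplit : ∀ k, (drift f 1 κ ε L c i t s x k - f s t).ofLp =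
      ((f (x k) t - f s t).ofLp - (α • (1 : Matrix (Fin n) (Fin n) ℝ)) *ᵥ (x k - s).ofLp) +
      ∑ l, ((α • (1 : Matrix (Fin m) (Fin m) ℝ) + κ • L i - (κ * ε) • Matrix.diagonal (c i)) k l) •
        (x l - s).ofLp := by
    intro k
    have hLs : ∑ l, L i k l • (x l).ofLp = ∑ l, L i k l • (x l - s).ofLp := by
      simp only [WithLp.ofLp_sub, smul_sub, Finset.sum_sub_distrib, ← Finset.sum_smul,
        (hL i).row_sum, zero_smul, sub_zero]
    have hδ : ∀ d : Fin m → ℝ, ∑ l, (Matrix.diagonal d k l) • (x l - s).ofLp =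
        d k • (x k - s).ofLp := by
      intro d
      rw [Finset.sum_eq_single k]
      · simp
      · intro l _ hl
        rw [Matrix.diagonal_apply_ne' _ hl, zero_smul]
      · simp
    have h1 := hδ 1
    simp only [Matrix.diagonal_one', Pi.one_apply, one_smul] at h1
    simp only [Matrix.sub_apply, Matrix.add_apply, Matrix.smul_apply, sub_smul, add_smul,
      Finset.sum_sub_distrib, Finset.sum_add_distrib, smul_assoc, ← Finset.smul_sum, h1, hδ (c i),
      ← hLs]
    simp only [drift, Matrix.toLpLin_one, LinearMap.id_coe, id_eq, WithLp.ofLp_sub, WithLp.ofLp_add,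
      WithLp.ofLp_smul, WithLp.ofLp_sum, Matrix.smul_mulVec, Matrix.one_mulVec]
    module
  have hk : ∀ k, w k * ((x k - s).ofLp ⬝ᵥ (G *ᵥ (drift f 1 κ ε L c i t s x k - f s t).ofLp)) ≤
      -β * (w k * ‖x k - s‖ ^ 2) +
      ∑ l, lyapMatrix α κ ε (L i) (c i) w k l * ((x k - s).ofLp ⬝ᵥ (G *ᵥ (x l - s).ofLp)) := by
    intro k
    rw [hsplit, Matrix.mulVec_add, dotProduct_add, mul_add]
    have hq := mul_le_mul_of_nonneg_left (hf.quad t ht (x k) s) (hw k)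
    rw [ofLp_dotProduct_self] at hq
    refine add_le_add (hq.trans_eq (by ring)) (le_of_eq ?_)
    rw [Matrix.mulVec_sum, dotProduct_sum, Finset.mul_sum]
    refine Finset.sum_congr rfl fun l _ => ?_
    rw [Matrix.mulVec_smul, dotProduct_smul, lyapMatrix, Matrix.diagonal_mul, smul_eq_mul, mul_assoc]
  have h1 := Finset.sum_le_sum fun k (_ : k ∈ Finset.univ) => hk k
  have h2 := sum_mul_dotProduct_mulVec_le hf.posDef (lyapMatrix α κ ε (L i) (c i) w)
    (fun k => (x k - s).ofLp)
  rw [Finset.sum_add_distrib, ← Finset.mul_sum] at h1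
  have h3 : energy G 1 (fun k => x k - s) = ∑ k, (x k - s).ofLp ⬝ᵥ (G *ᵥ (x k - s).ofLp) := by
    simp [energy]
  rw [h3]
  linarith

end Energy

section Path

variable {m n N : ℕ}

lemma tendsto_add_left_nhdsGT (t : ℝ) : Tendsto (fun h : ℝ => t + h) (𝓝[>] 0) (𝓝[>] t) := by
  refine tendsto_nhdsWithin_iff.2 ⟨?_, ?_⟩
  · have : Tendsto (fun h : ℝ => t + h) (𝓝 0) (𝓝 (t + 0)) := by
      exact (continuous_const.add continuous_id).tendsto 0
    rw [add_zero] at this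
    exact this.mono_left nhdsWithin_le_nhds
  · filter_upwards [self_mem_nhdsWithin] with h hh
    exact lt_add_of_pos_right t hh

lemma tendsto_inv_mul_sub_of_hasDerivWithinAt {V : ℝ → ℝ} {d t : ℝ}
    (h : HasDerivWithinAt V d (Set.Ici t) t) :
    Tendsto (fun h : ℝ => h⁻¹ * (V (t + h) - V t)) (𝓝[>] 0) (𝓝 d) := by
  have h1 := (hasDerivWithinAt_iff_tendsto_slope' (by simp)).1
    (h.mono Set.Ioi_subset_Ici_self)
  refine (h1.comp (tendsto_add_left_nhdsGT t)).congr fun u => ?_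
  simp [slope_def_field, div_eq_inv_mul]

variable {f : EuclideanSpace ℝ (Fin n) → ℝ → EuclideanSpace ℝ (Fin n)}
  {G : Matrix (Fin n) (Fin n) ℝ} {α β κ ε : ℝ} {L : Fin N → Matrix (Fin m) (Fin m) ℝ}
  {c : Fin N → Fin m → ℝ} {s : ℝ → EuclideanSpace ℝ (Fin n)} {r : ℝ → Fin N}
  {x : ℝ → Fin m → EuclideanSpace ℝ (Fin n)}

/-- Along a solution path the energy has a right derivative, bounded by the dissipation inequality
for the current mode `r t`. The node weights `w` need not be those of that mode. -/
lemma exists_hasDerivWithinAt_energy_path (hf : QUAD G α 1 β f)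
    (hs : ∀ t, 0 ≤ t → HasDerivWithinAt s (f (s t) t) (Set.Ici 0) t)
    (hL : ∀ i, IsCoupling (L i))
    (hx : ∀ t, 0 ≤ t → ∀ j, HasDerivWithinAt (fun u => x u j)
      (drift f 1 κ ε L c (r t) t (s t) (x t) j) (Set.Ici t) t)
    {w : Fin m → ℝ} (hw : ∀ k, 0 ≤ w k) {t : ℝ} (ht : 0 ≤ t) :
    ∃ d, HasDerivWithinAt (fun u => energy G w (fun k => x u k - s u)) d (Set.Ici t) t ∧
      d ≤ 2 * lambdaMax (symPart (lyapMatrix α κ ε (L (r t)) (c (r t)) w)) *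
          energy G 1 (fun k => x t k - s t) - 2 * β * ∑ k, w k * ‖x t k - s t‖ ^ 2 :=
  ⟨_, hasDerivWithinAt_energy hf.posDef w (e := fun u k => x u k - s u) fun k =>
    (hx t ht k).sub ((hs t ht).mono (Set.Ici_subset_Ici.2 ht)),
    sum_dotProduct_drift_le hf hL c κ ε hw (r t) ht (s t) (x t)⟩

lemma continuousOn_energy_path
    (hs : ∀ t, 0 ≤ t → HasDerivWithinAt s (f (s t) t) (Set.Ici 0) t)
    (hc : ∀ j, ContinuousOn (fun t => x t j) (Set.Ici 0)) (w : Fin m → ℝ) :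
    ContinuousOn (fun u => energy G w (fun k => x u k - s u)) (Set.Ici 0) :=
  (continuous_energy G w).comp_continuousOn <| continuousOn_pi.2 fun k =>
    (hc k).sub fun t ht => (hs t ht).continuousWithinAt

/-- The total energy grows at most exponentially, whatever the modes do. -/
lemma energy_one_le_exp (hf : QUAD G α 1 β f)
    (hs : ∀ t, 0 ≤ t → HasDerivWithinAt s (f (s t) t) (Set.Ici 0) t)
    (hL : ∀ i, IsCoupling (L i))
    (hc : ∀ j, ContinuousOn (fun t => x t j) (Set.Ici 0))
    (hx : ∀ t, 0 ≤ t → ∀ j, HasDerivWithinAt (fun u => x u j)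
      (drift f 1 κ ε L c (r t) t (s t) (x t) j) (Set.Ici t) t)
    {C : ℝ} (hC : ∀ i, 2 * lambdaMax (symPart (lyapMatrix α κ ε (L i) (c i) 1)) ≤ C)
    {t : ℝ} (ht : 0 ≤ t) :
    energy G 1 (fun k => x t k - s t) ≤ Real.exp (C * t) * energy G 1 (fun k => x 0 k - s 0) := by
  have h1 : ∀ k : Fin m, (0 : ℝ) ≤ (1 : Fin m → ℝ) k := fun _ => zero_le_one
  have hd := fun (u : ℝ) (hu : 0 ≤ u) => exists_hasDerivWithinAt_energy_path hf hs hL hx h1 hu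
  choose! d hd1 hd2 using hd
  have h := le_gronwallBound_of_liminf_deriv_right_le (K := C) (ε := 0) (a := 0) (b := t)
    (f := fun u => energy G 1 (fun k => x u k - s u)) (f' := d)
    ((continuousOn_energy_path hs hc 1).mono Set.Icc_subset_Ici_self)
    (fun u hu q hq => by
      simpa [slope_def_field, div_eq_inv_mul] using (hd1 u hu.1).liminf_right_slope_le hq) le_rfl
    (fun u hu => by
      have e0 := energy_nonneg hf.posDef h1 (fun k => x u k - s u)
      have e1 : 0 ≤ β * ∑ k, (1 : Fin m → ℝ) k * ‖x u k - s u‖ ^ 2 :=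
        mul_nonneg hf.beta_pos.le (Finset.sum_nonneg fun k _ => mul_nonneg (h1 k) (sq_nonneg _))
      have e2 := mul_le_mul_of_nonneg_right (hC (r u)) e0
      linarith [hd2 u hu.1]) t (Set.right_mem_Icc.2 ht)
  rwa [gronwallBound_ε0, sub_zero, mul_comm] at h

/-- A one-sided Lipschitz bound for the energy with any node weights. -/
lemma energy_sub_le (hf : QUAD G α 1 β f)
    (hs : ∀ t, 0 ≤ t → HasDerivWithinAt s (f (s t) t) (Set.Ici 0) t)
    (hL : ∀ i, IsCoupling (L i))
    (hc : ∀ j, ContinuousOn (fun t => x t j) (Set.Ici 0))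
    (hx : ∀ t, 0 ≤ t → ∀ j, HasDerivWithinAt (fun u => x u j)
      (drift f 1 κ ε L c (r t) t (s t) (x t) j) (Set.Ici t) t)
    {C : ℝ} (hC0 : 0 ≤ C) (hC : ∀ i, 2 * lambdaMax (symPart (lyapMatrix α κ ε (L i) (c i) 1)) ≤ C)
    {w : Fin m → ℝ} (hw : ∀ k, 0 ≤ w k)
    (hCw : ∀ i, 2 * lambdaMax (symPart (lyapMatrix α κ ε (L i) (c i) w)) ≤ C)
    {t t' T : ℝ} (ht : 0 ≤ t) (htt' : t ≤ t') (hT : t' ≤ T) :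
    energy G w (fun k => x t' k - s t') - energy G w (fun k => x t k - s t) ≤
      C * Real.exp (C * T) * energy G 1 (fun k => x 0 k - s 0) * (t' - t) := by
  have h1 : ∀ k : Fin m, (0 : ℝ) ≤ (1 : Fin m → ℝ) k := fun _ => zero_le_one
  have hd := fun (u : ℝ) (hu : 0 ≤ u) => exists_hasDerivWithinAt_energy_path hf hs hL hx hw hu
  choose! d hd1 hd2 using hd
  set D := C * Real.exp (C * T) * energy G 1 (fun k => x 0 k - s 0)
  have h := image_le_of_deriv_right_le_deriv_boundary (a := t) (b := t')
    (f := fun u => energy G w (fun k => x u k - s u)) (f' := d)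
    (B := fun u => energy G w (fun k => x t k - s t) + D * (u - t)) (B' := fun _ => D)
    ((continuousOn_energy_path hs hc w).mono fun u hu => ht.trans hu.1)
    (fun u hu => hd1 u (ht.trans hu.1)) (by simp) (by fun_prop)
    (fun u _ => by
      simpa using ((((hasDerivAt_id u).sub_const t).const_mul D).const_add
        (energy G w (fun k => x t k - s t))).hasDerivWithinAt)
    (fun u hu => by
      have hu0 := ht.trans hu.1
      have e0 := energy_nonneg hf.posDef h1 (fun k => x u k - s u)
      have e00 := energy_nonneg hf.posDef h1 (fun k => x 0 k - s 0)
      have e1 : 0 ≤ β * ∑ k, w k * ‖x u k - s u‖ ^ 2 :=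
        mul_nonneg hf.beta_pos.le (Finset.sum_nonneg fun k _ => mul_nonneg (hw k) (sq_nonneg _))
      have e2 := mul_le_mul_of_nonneg_right (hCw (r u)) e0
      have e3 := mul_le_mul_of_nonneg_left (energy_one_le_exp hf hs hL hc hx hC hu0) hC0
      have e4 : Real.exp (C * u) ≤ Real.exp (C * T) :=
        Real.exp_le_exp.2 (mul_le_mul_of_nonneg_left (hu.2.le.trans hT) hC0)
      have e5 := mul_le_mul_of_nonneg_left (mul_le_mul_of_nonneg_right e4 e00) hC0
      have e6 : D = C * (Real.exp (C * T) * energy G 1 (fun k => x 0 k - s 0)) := mul_assoc _ _ _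
      rw [e6]
      linarith [hd2 u hu0]) (Set.right_mem_Icc.2 htt')
  linarith

end Path

/-! ### A comparison principle for functions with downward jumps -/

/-- A function that starts below a continuous barrier `B`, cannot cross `B` to the right, and does
not jump upwards from the left, stays below `B`. Downward jumps are allowed. -/
lemma le_barrier_of_forall_eventually {φ B : ℝ → ℝ} (hB : Continuous B) (h0 : φ 0 ≤ B 0)
    (hr : ∀ t, 0 ≤ t → φ t ≤ B t → ∀ᶠ h in 𝓝[>] (0 : ℝ), φ (t + h) ≤ B (t + h))
    (hl : ∀ t, 0 < t → ∀ η, 0 < η → ∀ᶠ u in 𝓝[<] t, φ t ≤ φ u + η) {T : ℝ} (hT : 0 ≤ T) :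
    φ T ≤ B T := by
  set S : Set ℝ := {t | t ∈ Set.Icc 0 T ∧ ∀ u ∈ Set.Icc 0 t, φ u ≤ B u} with hS
  have h0S : (0 : ℝ) ∈ S := ⟨⟨le_rfl, hT⟩, fun u hu => by
    rw [le_antisymm hu.2 hu.1]; exact h0⟩
  have hbdd : BddAbove S := ⟨T, fun t ht => ht.1.2⟩
  set τ := sSup S
  have hτ0 : 0 ≤ τ := le_csSup hbdd h0S
  have hτT : τ ≤ T := csSup_le ⟨0, h0S⟩ fun t ht => ht.1.2
  have hlt : ∀ u, 0 ≤ u → u < τ → φ u ≤ B u := fun u hu hut => by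
    obtain ⟨t, ht, hut'⟩ := exists_lt_of_lt_csSup ⟨0, h0S⟩ hut
    exact ht.2 u ⟨hu, hut'.le⟩
  have hτB : φ τ ≤ B τ := by
    rcases hτ0.eq_or_lt with h | h
    · rw [← h]; exact h0
    · refine le_of_forall_pos_le_add fun η hη => ?_
      have e1 : ∀ᶠ u in 𝓝[<] τ, B u < B τ + η / 2 :=
        (hB.continuousAt.eventually_lt_const (by linarith)).filter_mono nhdsWithin_le_nhds
      have e2 : ∀ᶠ u in 𝓝[<] τ, 0 < u :=
        (lt_mem_nhds h).filter_mono nhdsWithin_le_nhds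
      obtain ⟨u, hu1, hu2, hu3, hu4⟩ :=
        (e1.and (e2.and ((hl τ h (η / 2) (by linarith)).and self_mem_nhdsWithin))).exists
      linarith [hlt u hu2.le hu4]
  have hτS : ∀ u ∈ Set.Icc 0 τ, φ u ≤ B u := fun u hu => by
    rcases hu.2.eq_or_lt with h | h
    · rw [h]; exact hτB
    · exact hlt u hu.1 h
  rcases hτT.eq_or_lt with h | h
  · rw [← h]; exact hτB
  · exfalso
    obtain ⟨a, ha, hav⟩ := mem_nhdsGT_iff_exists_Ioo_subset.1 (hr τ hτ0 hτB)
    have ha : 0 < a := ha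
    have hb : 0 < min (a / 2) (T - τ) := lt_min (by linarith) (by linarith)
    have hmem : τ + min (a / 2) (T - τ) ∈ S := by
      refine ⟨⟨by linarith, by linarith [min_le_right (a / 2) (T - τ)]⟩, fun u hu => ?_⟩
      rcases le_or_gt u τ with h' | h'
      · exact hτS u ⟨hu.1, h'⟩
      · have := hav (show u - τ ∈ Set.Ioo 0 a from
          ⟨by linarith, by linarith [hu.2, min_le_left (a / 2) (T - τ)]⟩)
        simpa using this
    linarith [le_csSup hbdd hmem]

/-- Exponential decay from the Dini inequality `D⁺ φ ≤ -δ φ` and the absence of upward jumps. -/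
lemma le_mul_exp_of_forall_eventually {φ : ℝ → ℝ} {δ : ℝ} (hδ : 0 ≤ δ)
    (hr : ∀ t, 0 ≤ t → ∀ η, 0 < η → ∀ᶠ h in 𝓝[>] (0 : ℝ),
      φ (t + h) ≤ φ t + h * (-δ * φ t + η))
    (hl : ∀ t, 0 < t → ∀ η, 0 < η → ∀ᶠ u in 𝓝[<] t, φ t ≤ φ u + η) (h0 : 0 ≤ φ 0)
    {T : ℝ} (hT : 0 ≤ T) : φ T ≤ φ 0 * Real.exp (-δ * T) := by
  have key : ∀ η, 0 < η → φ T ≤ Real.exp (-δ * T) * (φ 0 + η * T) := by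
    intro η hη
    refine le_barrier_of_forall_eventually (B := fun t => Real.exp (-δ * t) * (φ 0 + η * t))
      (by fun_prop) (by simp) (fun t ht hφ => ?_) hl hT
    have e1 : ∀ᶠ h in 𝓝[>] (0 : ℝ), h < 1 :=
      (gt_mem_nhds one_pos).filter_mono nhdsWithin_le_nhds
    have e2 : ∀ᶠ h in 𝓝[>] (0 : ℝ), δ * h < 1 := by
      have : Tendsto (fun h : ℝ => δ * h) (𝓝 0) (𝓝 (δ * 0)) :=
        (continuous_const.mul continuous_id).tendsto 0
      exact (this.eventually_lt_const (by simp)).filter_mono nhdsWithin_le_nhds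
    filter_upwards [hr t ht _ (mul_pos hη (Real.exp_pos (-δ * (t + 1)))), e1, e2,
      self_mem_nhdsWithin] with h h1 h2 h3 h4
    have h4 : 0 < h := h4
    have a1 : φ t * (1 - δ * h) ≤ Real.exp (-δ * t) * (φ 0 + η * t) * (1 - δ * h) :=
      mul_le_mul_of_nonneg_right hφ (by linarith)
    have a2 : 1 - δ * h ≤ Real.exp (-δ * h) := by
      have := Real.add_one_le_exp (-δ * h); linarith
    have a3 : Real.exp (-δ * t) * (φ 0 + η * t) * (1 - δ * h) ≤
        Real.exp (-δ * t) * (φ 0 + η * t) * Real.exp (-δ * h) :=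
      mul_le_mul_of_nonneg_left a2 (by positivity)
    have a4 : Real.exp (-δ * (t + 1)) ≤ Real.exp (-δ * (t + h)) :=
      Real.exp_le_exp.2 (by nlinarith)
    have a5 : Real.exp (-δ * (t + h)) = Real.exp (-δ * t) * Real.exp (-δ * h) := by
      rw [← Real.exp_add]; ring_nf
    have a6 := mul_le_mul_of_nonneg_left a4 (mul_pos h4 hη).le
    have a7 : Real.exp (-δ * (t + h)) * (φ 0 + η * (t + h)) =
        Real.exp (-δ * t) * (φ 0 + η * t) * Real.exp (-δ * h) +
          h * η * Real.exp (-δ * (t + h)) := by rw [a5]; ring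
    rw [a7]
    linarith
  have hlim : Tendsto (fun η : ℝ => Real.exp (-δ * T) * (φ 0 + η * T)) (𝓝[>] 0)
      (𝓝 (Real.exp (-δ * T) * (φ 0 + 0 * T))) :=
    ((by fun_prop : Continuous fun η : ℝ => Real.exp (-δ * T) * (φ 0 + η * T)).tendsto 0).mono_left
      nhdsWithin_le_nhds
  have := ge_of_tendsto hlim (by filter_upwards [self_mem_nhdsWithin] with η hη using key η hη)
  linarith

/-! ### The Markov property with an independent initial value -/

/-- Finite measures that agree on intersections `A ∩ B`, `A` in `m₁` and `B` in `m₂`, agree on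
`m₁ ⊔ m₂`. -/
lemma trim_sup_eq_of_inter {Ω : Type*} {m₁ m₂ mΩ : MeasurableSpace Ω} (h₁ : m₁ ≤ mΩ) (h₂ : m₂ ≤ mΩ)
    {ν₁ ν₂ : Measure Ω} [IsFiniteMeasure ν₁]
    (h : ∀ A B, MeasurableSet[m₁] A → MeasurableSet[m₂] B → ν₁ (A ∩ B) = ν₂ (A ∩ B)) :
    ν₁.trim (sup_le h₁ h₂) = ν₂.trim (sup_le h₁ h₂) := by
  have hF : m₁ ⊔ m₂ ≤ mΩ := sup_le h₁ h₂
  have hfin : IsFiniteMeasure (ν₁.trim hF) := isFiniteMeasure_trim hF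
  have hmeas : ∀ A B, MeasurableSet[m₁] A → MeasurableSet[m₂] B → MeasurableSet[m₁ ⊔ m₂] (A ∩ B) :=
    fun A B hA hB => MeasurableSet.inter ((le_sup_left : m₁ ≤ m₁ ⊔ m₂) A hA)
      ((le_sup_right : m₂ ≤ m₁ ⊔ m₂) B hB)
  refine @ext_of_generate_finite Ω (m₁ ⊔ m₂) _ _
    {S | ∃ A B, MeasurableSet[m₁] A ∧ MeasurableSet[m₂] B ∧ S = A ∩ B} ?_ ?_ hfin ?_ ?_
  · refine le_antisymm (sup_le ?_ ?_) (MeasurableSpace.generateFrom_le ?_)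
    · exact fun A hA => MeasurableSpace.measurableSet_generateFrom
        ⟨A, Set.univ, hA, MeasurableSet.univ, (Set.inter_univ A).symm⟩
    · exact fun B hB => MeasurableSpace.measurableSet_generateFrom
        ⟨Set.univ, B, MeasurableSet.univ, hB, (Set.univ_inter B).symm⟩
    · rintro _ ⟨A, B, hA, hB, rfl⟩
      exact hmeas A B hA hB
  · rintro _ ⟨A, B, hA, hB, rfl⟩ _ ⟨A', B', hA', hB', rfl⟩ -
    exact ⟨A ∩ A', B ∩ B', hA.inter hA', hB.inter hB', Set.inter_inter_inter_comm _ _ _ _⟩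
  · rintro _ ⟨A, B, hA, hB, rfl⟩
    rw [trim_measurableSet_eq hF (hmeas A B hA hB), trim_measurableSet_eq hF (hmeas A B hA hB)]
    exact h A B hA hB
  · rw [trim_measurableSet_eq hF MeasurableSet.univ, trim_measurableSet_eq hF MeasurableSet.univ]
    simpa using h Set.univ Set.univ MeasurableSet.univ MeasurableSet.univ

section Markov

variable {Ω : Type*} {N : ℕ} {σ : ℝ → Ω → Fin N}

lemma history_mono {t t' : ℝ} (h : t ≤ t') : history σ t ≤ history σ t' :=
  biSup_mono fun _ hr => ⟨hr.1, hr.2.trans h⟩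

lemma measurableSet_history {t : ℝ} (ht : 0 ≤ t) (i : Fin N) :
    MeasurableSet[history σ t] (σ t ⁻¹' {i}) :=
  (le_iSup₂_of_le (f := fun r (_ : r ∈ Set.Icc (0 : ℝ) t) => MeasurableSpace.comap (σ r) ⊤)
    t ⟨ht, le_rfl⟩ le_rfl) _ ⟨{i}, trivial, rfl⟩

lemma history_le_comap_path (t : ℝ) :
    history σ t ≤ MeasurableSpace.comap (fun ω (r : ℝ≥0) => σ r ω) inferInstance := by
  refine iSup₂_le fun r hr => ?_
  have : σ r = (fun y : ℝ≥0 → Fin N => y ⟨r, hr.1⟩) ∘ fun ω (r : ℝ≥0) => σ r ω := rfl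
  rw [this, ← MeasurableSpace.comap_comp]
  exact MeasurableSpace.comap_mono (measurable_pi_apply _).comap_le

lemma apply_mode_eq_sum_indicator {Y : Ω → Fin N} (g : Fin N → Ω → ℝ) :
    (fun ω => g (Y ω) ω) = fun ω => ∑ j, (Y ⁻¹' {j}).indicator (g j) ω := by
  funext ω
  rw [Finset.sum_eq_single (Y ω)]
  · simp
  · intro j _ hj
    exact Set.indicator_of_notMem (s := Y ⁻¹' {j}) (fun h : Y ω = j => hj h.symm) (g j)
  · simp

variable [mΩ : MeasurableSpace Ω] {μ : Measure Ω} [IsProbabilityMeasure μ]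

lemma history_le (hσ : ∀ t, 0 ≤ t → Measurable (σ t)) (t : ℝ) : history σ t ≤ mΩ :=
  iSup₂_le fun r hr => (hσ r hr.1).comap_le

/-- The Markov property for functionals of an independent random variable `X` and the history of
the chain: `E[g 1{σ_t = i} 1{σ_{t+h} = j}] = p_{ij}(h) E[g 1{σ_t = i}]`. -/
lemma setIntegral_inter_eq_mul {E : Type*} [mE : MeasurableSpace E] {X : Ω → E} (hX : Measurable X)
    (hσ : ∀ t, 0 ≤ t → Measurable (σ t))
    (hind : IndepFun X (fun ω (t : ℝ≥0) => σ t ω) μ) {p : ℝ → Matrix (Fin N) (Fin N) ℝ}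
    (hp : ∀ h, 0 ≤ h → ∀ i j, 0 ≤ p h i j)
    (hM : ∀ t h, 0 ≤ t → 0 ≤ h → ∀ i j, ∀ A : Set Ω, MeasurableSet[history σ t] A →
      μ.real (A ∩ σ t ⁻¹' {i} ∩ σ (t + h) ⁻¹' {j}) = μ.real (A ∩ σ t ⁻¹' {i}) * p h i j)
    {t h : ℝ} (ht : 0 ≤ t) (hh : 0 ≤ h) (i j : Fin N) {g : Ω → ℝ}
    (hg : AEStronglyMeasurable[MeasurableSpace.comap X mE ⊔ history σ t] g μ) :
    ∫ ω in σ t ⁻¹' {i} ∩ σ (t + h) ⁻¹' {j}, g ω ∂μ = p h i j * ∫ ω in σ t ⁻¹' {i}, g ω ∂μ := by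
  have hXle := hX.comap_le
  have hHle := history_le hσ t
  have hind' := (Indep_iff _ _ _).1 ((IndepFun_iff_Indep _ _ _).1 hind)
  have hi : MeasurableSet (σ t ⁻¹' {i}) := hσ t ht (measurableSet_singleton i)
  have hj : MeasurableSet (σ (t + h) ⁻¹' {j}) := hσ _ (add_nonneg ht hh) (measurableSet_singleton j)
  have hM' : ∀ B, MeasurableSet[history σ t] B →
      μ (B ∩ σ t ⁻¹' {i} ∩ σ (t + h) ⁻¹' {j}) =
        ENNReal.ofReal (p h i j) * μ (B ∩ σ t ⁻¹' {i}) := by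
    intro B hB
    have := hM t h ht hh i j B hB
    rw [← ENNReal.ofReal_toReal (measure_ne_top μ (B ∩ σ t ⁻¹' {i} ∩ σ (t + h) ⁻¹' {j})),
      ← ENNReal.ofReal_toReal (measure_ne_top μ (B ∩ σ t ⁻¹' {i})),
      ← ENNReal.ofReal_mul (hp h hh i j)]
    congr 1
    rw [mul_comm]
    exact this
  have htrim : (μ.restrict (σ t ⁻¹' {i} ∩ σ (t + h) ⁻¹' {j})).trim (sup_le hXle hHle) =
      (ENNReal.ofReal (p h i j) • μ.restrict (σ t ⁻¹' {i})).trim (sup_le hXle hHle) := by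
    refine trim_sup_eq_of_inter hXle hHle fun A B hA hB => ?_
    have hAB : MeasurableSet (A ∩ B) := (hXle A hA).inter (hHle B hB)
    rw [Measure.smul_apply, Measure.restrict_apply hAB, Measure.restrict_apply hAB, smul_eq_mul]
    have e1 : A ∩ B ∩ (σ t ⁻¹' {i} ∩ σ (t + h) ⁻¹' {j}) =
        A ∩ (B ∩ σ t ⁻¹' {i} ∩ σ (t + h) ⁻¹' {j}) := by simp only [Set.inter_assoc]
    rw [e1, Set.inter_assoc A B]
    have hBi : MeasurableSet[history σ t] (B ∩ σ t ⁻¹' {i}) :=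
      MeasurableSet.inter hB (measurableSet_history ht i)
    have hBij : MeasurableSet[history σ (t + h)] (B ∩ σ t ⁻¹' {i} ∩ σ (t + h) ⁻¹' {j}) :=
      MeasurableSet.inter (history_mono (by linarith) _ hBi)
        (measurableSet_history (add_nonneg ht hh) j)
    rw [hind' _ _ hA (history_le_comap_path _ _ hBij), hind' _ _ hA (history_le_comap_path _ _ hBi),
      hM' B hB]
    ring
  obtain ⟨g', hg', hgg'⟩ := hg
  rw [integral_congr_ae (ae_restrict_of_ae hgg'), integral_congr_ae (ae_restrict_of_ae hgg'),
    integral_trim (sup_le hXle hHle) hg', htrim, ← integral_trim (sup_le hXle hHle) hg',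
    integral_smul_measure, ENNReal.toReal_ofReal (hp h hh i j), smul_eq_mul]

lemma integrable_apply_mode {ν : Measure Ω} {Y : Ω → Fin N} (hY : Measurable Y)
    {g : Fin N → Ω → ℝ} (hg : ∀ j, Integrable (g j) ν) : Integrable (fun ω => g (Y ω) ω) ν := by
  rw [apply_mode_eq_sum_indicator]
  exact integrable_finsetSum _ fun j _ => (hg j).indicator (hY (measurableSet_singleton j))

lemma integral_apply_mode {ν : Measure Ω} {Y : Ω → Fin N} (hY : Measurable Y)
    {g : Fin N → Ω → ℝ} (hg : ∀ j, Integrable (g j) ν) :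
    ∫ ω, g (Y ω) ω ∂ν = ∑ j, ∫ ω in Y ⁻¹' {j}, g j ω ∂ν := by
  rw [apply_mode_eq_sum_indicator, integral_finsetSum _ fun j _ =>
    (hg j).indicator (hY (measurableSet_singleton j))]
  exact Finset.sum_congr rfl fun j _ => integral_indicator (hY (measurableSet_singleton j))

/-- The expectation of a functional `g` of the past, selected by the mode of the chain a time `h`
later. -/
lemma integral_apply_mode_add {E : Type*} [mE : MeasurableSpace E] {X : Ω → E} (hX : Measurable X)
    (hσ : ∀ t, 0 ≤ t → Measurable (σ t))
    (hind : IndepFun X (fun ω (t : ℝ≥0) => σ t ω) μ) {p : ℝ → Matrix (Fin N) (Fin N) ℝ}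
    (hp : ∀ h, 0 ≤ h → ∀ i j, 0 ≤ p h i j)
    (hM : ∀ t h, 0 ≤ t → 0 ≤ h → ∀ i j, ∀ A : Set Ω, MeasurableSet[history σ t] A →
      μ.real (A ∩ σ t ⁻¹' {i} ∩ σ (t + h) ⁻¹' {j}) = μ.real (A ∩ σ t ⁻¹' {i}) * p h i j)
    {t h : ℝ} (ht : 0 ≤ t) (hh : 0 ≤ h) {g : Fin N → Ω → ℝ}
    (hg : ∀ j, AEStronglyMeasurable[MeasurableSpace.comap X mE ⊔ history σ t] (g j) μ)
    (hgi : ∀ j, Integrable (g j) μ) :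
    ∫ ω, g (σ (t + h) ω) ω ∂μ = ∑ i, ∑ j, p h i j * ∫ ω in σ t ⁻¹' {i}, g j ω ∂μ := by
  rw [integral_apply_mode (hσ _ (add_nonneg ht hh)) hgi, Finset.sum_comm]
  refine Finset.sum_congr rfl fun j _ => ?_
  rw [integral_apply_mode (Y := σ t) (g := fun _ => g j) (hσ t ht) fun _ => (hgi j).restrict]
  refine Finset.sum_congr rfl fun i _ => ?_
  rw [Measure.restrict_restrict (hσ t ht (measurableSet_singleton i))]
  exact setIntegral_inter_eq_mul hX hσ hind hp hM ht hh i j (hg j)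

end Markov

/-! ### Generators -/

namespace IsTransitionFunction

variable {N : ℕ} {Q : Matrix (Fin N) (Fin N) ℝ} {p : ℝ → Matrix (Fin N) (Fin N) ℝ}

lemma tendsto_div (hp : IsTransitionFunction Q p) (i j : Fin N) :
    Tendsto (fun h => h⁻¹ * (p h i j - (1 : Matrix (Fin N) (Fin N) ℝ) i j)) (𝓝[>] 0)
      (𝓝 (Q i j)) := by
  have h1 := (hp.generator i j).tendsto_div_nhds_zero.add_const (Q i j)
  rw [zero_add] at h1
  refine h1.congr' ?_
  filter_upwards [self_mem_nhdsWithin] with h hh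
  have : h ≠ 0 := ne_of_gt hh
  field_simp
  ring

lemma tendsto_sub (hp : IsTransitionFunction Q p) (i j : Fin N) :
    Tendsto (fun h => p h i j - (1 : Matrix (Fin N) (Fin N) ℝ) i j) (𝓝[>] 0) (𝓝 0) := by
  have h0 : Tendsto (fun h : ℝ => h) (𝓝[>] 0) (𝓝 0) := tendsto_id.mono_left nhdsWithin_le_nhds
  have h1 := h0.mul (hp.tendsto_div i j)
  rw [zero_mul] at h1
  refine h1.congr' ?_
  filter_upwards [self_mem_nhdsWithin] with h hh
  rw [mul_inv_cancel_left₀ (ne_of_gt hh)]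

lemma generator_nonneg (hp : IsTransitionFunction Q p) {i j : Fin N} (hij : i ≠ j) : 0 ≤ Q i j := by
  refine ge_of_tendsto (hp.tendsto_div i j) ?_
  filter_upwards [self_mem_nhdsWithin] with h hh
  have hh : 0 < h := hh
  rw [Matrix.one_apply_ne hij, sub_zero]
  exact mul_nonneg (inv_nonneg.2 hh.le) (hp.nonneg h hh.le i j)

lemma generator_row_sum (hp : IsTransitionFunction Q p) (i : Fin N) : ∑ j, Q i j = 0 := by
  refine tendsto_nhds_unique (tendsto_finsetSum Finset.univ fun j _ => hp.tendsto_div i j)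
    (tendsto_const_nhds.congr' ?_)
  filter_upwards [self_mem_nhdsWithin] with h hh
  have hh : 0 < h := hh
  rw [← Finset.mul_sum, Finset.sum_sub_distrib, hp.row_sum h hh.le]
  simp [Matrix.one_apply]

end IsTransitionFunction

/-! ### Mean-square decay of the mode-dependent Lyapunov function -/

section MeanSquare

variable {Ω : Type*} {m n N : ℕ}
  {f : EuclideanSpace ℝ (Fin n) → ℝ → EuclideanSpace ℝ (Fin n)}
  {G : Matrix (Fin n) (Fin n) ℝ} {α β κ ε : ℝ} {L : Fin N → Matrix (Fin m) (Fin m) ℝ}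
  {c : Fin N → Fin m → ℝ} {s : ℝ → EuclideanSpace ℝ (Fin n)} {σ : ℝ → Ω → Fin N}
  {x : ℝ → Ω → Fin m → EuclideanSpace ℝ (Fin n)} {p : Fin N → Fin m → ℝ}

/-- The energy of the errors `x t ω k - s t` of a process, with node weights `w`. -/
noncomputable def errEnergy (G : Matrix (Fin n) (Fin n) ℝ) (s : ℝ → EuclideanSpace ℝ (Fin n))
    (x : ℝ → Ω → Fin m → EuclideanSpace ℝ (Fin n)) (w : Fin m → ℝ) (t : ℝ) (ω : Ω) : ℝ :=
  energy G w (fun k => x t ω k - s t)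

lemma errEnergy_nonneg (hG : G.PosDef) {w : Fin m → ℝ} (hw : ∀ k, 0 ≤ w k) (t : ℝ) (ω : Ω) :
    0 ≤ errEnergy G s x w t ω :=
  energy_nonneg hG hw _

/-- The bound `2 λ_M(A_iˢ) ∑ e_kᵀ G e_k - 2 β ∑ p^i_k ‖e_k‖²` for the derivative of the energy with
weights `p i` while the chain is in the mode `i`. -/
noncomputable def dissipation (G : Matrix (Fin n) (Fin n) ℝ) (α β κ ε : ℝ)
    (L : Fin N → Matrix (Fin m) (Fin m) ℝ) (c p : Fin N → Fin m → ℝ)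
    (s : ℝ → EuclideanSpace ℝ (Fin n)) (x : ℝ → Ω → Fin m → EuclideanSpace ℝ (Fin n))
    (i : Fin N) (t : ℝ) (ω : Ω) : ℝ :=
  2 * lambdaMax (symPart (lyapMatrix α κ ε (L i) (c i) (p i))) * errEnergy G s x 1 t ω
    - 2 * β * ∑ k, p i k * ‖x t ω k - s t‖ ^ 2

/-- The Lyapunov inequality `B_i + ∑_j q_{ij} V_j ≤ -(2 β / g) V_i`, where `V_j` is the energy with
weights `p j` and `B_i` the dissipation in the mode `i`. The jumps contribute at most
`q_i p_max` times the total energy, which the eigenvalue `λ_M(A_iˢ)` compensates; what remains is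
the term with `β`. -/
lemma dissipation_add_generator_le (hf : QUAD G α 1 β f) {Q : Matrix (Fin N) (Fin N) ℝ}
    (hQ : ∀ i j, i ≠ j → 0 ≤ Q i j) (hQ0 : ∀ i, ∑ j, Q i j = 0) (hp : ∀ i k, 0 < p i k) (hm : 0 < m)
    (hrate : ∀ i, -Q i i ≤
      -lambdaMax (symPart (lyapMatrix α κ ε (L i) (c i) (p i))) /
        ⨆ j, lambdaMax (Matrix.diagonal (p j)))
    {g : ℝ} (hg : 0 < g) (hgle : ∀ (w : Fin m → ℝ), (∀ k, 0 ≤ w k) →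
      ∀ e : Fin m → EuclideanSpace ℝ (Fin n), energy G w e ≤ g * ∑ k, w k * ‖e k‖ ^ 2)
    (i : Fin N) (t : ℝ) (ω : Ω) :
    dissipation G α β κ ε L c p s x i t ω + ∑ j, Q i j * errEnergy G s x (p j) t ω ≤
      -(2 * β / g) * errEnergy G s x (p i) t ω := by
  set W := ⨆ j, lambdaMax (Matrix.diagonal (p j))
  set lam := lambdaMax (symPart (lyapMatrix α κ ε (L i) (c i) (p i))) with hlam
  have hpW : ∀ j k, p j k ≤ W := fun j k => (le_lambdaMax_diagonal (p j) k).trans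
    (le_ciSup (f := fun j => lambdaMax (Matrix.diagonal (p j))) (Set.finite_range _).bddAbove j)
  have hW : 0 < W := (hp i ⟨0, hm⟩).trans_le (hpW i _)
  have hqi : 0 ≤ -Q i i := by
    have := hQ0 i
    rw [← Finset.add_sum_erase _ _ (Finset.mem_univ i)] at this
    have h2 : 0 ≤ ∑ j ∈ Finset.univ.erase i, Q i j :=
      Finset.sum_nonneg fun j hj => hQ i j (Finset.ne_of_mem_erase hj).symm
    linarith
  have hr : -Q i i * W ≤ -lam := (le_div_iff₀ hW).1 (hrate i)
  have hE : 0 ≤ errEnergy G s x 1 t ω := energy_nonneg hf.posDef (fun _ => zero_le_one) _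
  have hVi : 0 ≤ errEnergy G s x (p i) t ω := energy_nonneg hf.posDef (fun k => (hp i k).le) _
  have hjump : ∑ j, Q i j * errEnergy G s x (p j) t ω ≤ -Q i i * (W * errEnergy G s x 1 t ω) := by
    rw [← Finset.add_sum_erase _ _ (Finset.mem_univ i)]
    have h1 : ∑ j ∈ Finset.univ.erase i, Q i j * errEnergy G s x (p j) t ω ≤
        ∑ j ∈ Finset.univ.erase i, Q i j * (W * errEnergy G s x 1 t ω) :=
      Finset.sum_le_sum fun j hj => mul_le_mul_of_nonneg_left
        (energy_le_mul_energy_one hf.posDef (hpW j) _) (hQ i j (Finset.ne_of_mem_erase hj).symm)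
    have h2 : ∑ j ∈ Finset.univ.erase i, Q i j = -Q i i := by
      have := hQ0 i
      rw [← Finset.add_sum_erase _ _ (Finset.mem_univ i)] at this
      linarith
    rw [← Finset.sum_mul, h2] at h1
    nlinarith
  have hβ : 2 * β / g * errEnergy G s x (p i) t ω ≤ 2 * β * ∑ k, p i k * ‖x t ω k - s t‖ ^ 2 := by
    rw [div_mul_eq_mul_div, div_le_iff₀ hg]
    have := mul_le_mul_of_nonneg_left
      (hgle (p i) (fun k => (hp i k).le) (fun k => x t ω k - s t)) hf.beta_pos.le
    simp only [errEnergy]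
    linarith
  have h3 := mul_le_mul_of_nonneg_right hr hE
  have h4 : 0 ≤ -Q i i * W * errEnergy G s x 1 t ω := mul_nonneg (mul_nonneg hqi hW.le) hE
  have h5 : dissipation G α β κ ε L c p s x i t ω = 2 * lam * errEnergy G s x 1 t ω
    - 2 * β * ∑ k, p i k * ‖x t ω k - s t‖ ^ 2 := rfl
  rw [h5]
  linarith

variable [mΩ : MeasurableSpace Ω] {μ : Measure Ω}

lemma aestronglyMeasurable_errEnergy {m' : MeasurableSpace Ω} {t : ℝ} (w : Fin m → ℝ)
    (hx : AEStronglyMeasurable[m'] (x t) μ) : AEStronglyMeasurable[m'] (errEnergy G s x w t) μ := by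
  have : Continuous fun y : Fin m → EuclideanSpace ℝ (Fin n) => energy G w (fun k => y k - s t) :=
    (continuous_energy G w).comp (by fun_prop)
  exact this.comp_aestronglyMeasurable hx

lemma aestronglyMeasurable_solution (hσ : ∀ t, 0 ≤ t → Measurable (σ t))
    (hx : IsSolution μ f 1 κ ε L c s σ x) {t : ℝ} (ht : 0 ≤ t) : AEStronglyMeasurable (x t) μ :=
  (hx.adapted t ht).mono (sup_le hx.measurable_init.comap_le (history_le hσ t))

lemma ae_errEnergy_one_le (hf : QUAD G α 1 β f)
    (hs : ∀ t, 0 ≤ t → HasDerivWithinAt s (f (s t) t) (Set.Ici 0) t)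
    (hL : ∀ i, IsCoupling (L i)) (hx : IsSolution μ f 1 κ ε L c s σ x)
    {C : ℝ} (hC : ∀ i, 2 * lambdaMax (symPart (lyapMatrix α κ ε (L i) (c i) 1)) ≤ C)
    {t : ℝ} (ht : 0 ≤ t) :
    ∀ᵐ ω ∂μ, errEnergy G s x 1 t ω ≤ Real.exp (C * t) * errEnergy G s x 1 0 ω := by
  filter_upwards [hx.continuousOn, hx.equation] with ω h1 h2
  exact energy_one_le_exp (r := fun t => σ t ω) (x := fun t => x t ω) hf hs hL h1 h2 hC ht

lemma integrable_errEnergy (hG : G.PosDef) (hσ : ∀ t, 0 ≤ t → Measurable (σ t))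
    (hx : IsSolution μ f 1 κ ε L c s σ x) {t : ℝ} (ht : 0 ≤ t)
    (h1 : Integrable (errEnergy G s x 1 t) μ) {w : Fin m → ℝ} (hw : ∀ k, 0 ≤ w k) :
    Integrable (errEnergy G s x w t) μ := by
  refine Integrable.mono' (h1.const_mul (∑ k, w k))
    (aestronglyMeasurable_errEnergy w (aestronglyMeasurable_solution hσ hx ht))
    (Eventually.of_forall fun ω => ?_)
  rw [Real.norm_of_nonneg (errEnergy_nonneg hG hw _ _)]
  exact energy_le_mul_energy_one hG
    (fun k => Finset.single_le_sum (fun k _ => hw k) (Finset.mem_univ k)) _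

lemma integrable_norm_sq_error (hG : G.PosDef) (hσ : ∀ t, 0 ≤ t → Measurable (σ t))
    (hx : IsSolution μ f 1 κ ε L c s σ x) {t : ℝ} (ht : 0 ≤ t)
    (h1 : Integrable (errEnergy G s x 1 t) μ) (k : Fin m) :
    Integrable (fun ω => ‖x t ω k - s t‖ ^ 2) μ := by
  obtain ⟨g, hg, hle⟩ := exists_le_energy (m := m) hG
  refine Integrable.mono' (h1.const_mul g⁻¹) ?_ (Eventually.of_forall fun ω => ?_)
  · have : Continuous fun y : Fin m → EuclideanSpace ℝ (Fin n) => ‖y k - s t‖ ^ 2 := by fun_prop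
    exact this.comp_aestronglyMeasurable (aestronglyMeasurable_solution hσ hx ht)
  · rw [Real.norm_of_nonneg (sq_nonneg _), ← div_eq_inv_mul, le_div_iff₀ hg, mul_comm]
    exact hle (fun k => x t ω k - s t) k

lemma integrable_dissipation (hG : G.PosDef) (hσ : ∀ t, 0 ≤ t → Measurable (σ t))
    (hx : IsSolution μ f 1 κ ε L c s σ x) {t : ℝ} (ht : 0 ≤ t)
    (h1 : Integrable (errEnergy G s x 1 t) μ) (i : Fin N) :
    Integrable (dissipation G α β κ ε L c p s x i t) μ :=
  (h1.const_mul _).sub ((integrable_finsetSum Finset.univ fun k _ =>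
    (integrable_norm_sq_error hG hσ hx ht h1 k).const_mul (p i k)).const_mul (2 * β))

variable [IsProbabilityMeasure μ]

lemma integrable_errEnergy_zero (hG : G.PosDef) (hσ : ∀ t, 0 ≤ t → Measurable (σ t))
    (hx : IsSolution μ f 1 κ ε L c s σ x) (hx0 : ∀ j, MemLp (fun ω => x 0 ω j) 2 μ) :
    Integrable (errEnergy G s x 1 0) μ := by
  obtain ⟨g, hg, hle⟩ := exists_energy_le (m := m) hG
  have hsq : ∀ k, Integrable (fun ω => ‖x 0 ω k - s 0‖ ^ 2) μ := fun k =>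
    ((hx0 k).sub (memLp_const (s 0))).integrable_norm_pow two_ne_zero
  refine Integrable.mono' ((integrable_finsetSum Finset.univ fun k _ => hsq k).const_mul g)
    (aestronglyMeasurable_errEnergy 1 (aestronglyMeasurable_solution hσ hx le_rfl))
    (Eventually.of_forall fun ω => ?_)
  rw [Real.norm_of_nonneg (errEnergy_nonneg hG (w := 1) (fun _ => zero_le_one) _ _)]
  simpa [errEnergy] using hle 1 (fun _ => zero_le_one) (fun k => x 0 ω k - s 0)

lemma integrable_errEnergy_one (hf : QUAD G α 1 β f)
    (hs : ∀ t, 0 ≤ t → HasDerivWithinAt s (f (s t) t) (Set.Ici 0) t)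
    (hL : ∀ i, IsCoupling (L i)) (hσ : ∀ t, 0 ≤ t → Measurable (σ t))
    (hx : IsSolution μ f 1 κ ε L c s σ x) (hx0 : ∀ j, MemLp (fun ω => x 0 ω j) 2 μ)
    {C : ℝ} (hC : ∀ i, 2 * lambdaMax (symPart (lyapMatrix α κ ε (L i) (c i) 1)) ≤ C)
    {t : ℝ} (ht : 0 ≤ t) : Integrable (errEnergy G s x 1 t) μ := by
  refine Integrable.mono' ((integrable_errEnergy_zero hf.posDef hσ hx hx0).const_mul
    (Real.exp (C * t))) (aestronglyMeasurable_errEnergy 1 (aestronglyMeasurable_solution hσ hx ht)) ?_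
  filter_upwards [ae_errEnergy_one_le hf hs hL hx hC ht] with ω h
  rwa [Real.norm_of_nonneg (errEnergy_nonneg hf.posDef (w := 1) (fun _ => zero_le_one) _ _)]

/-- The contribution of the motion of the nodes to the growth of the expected energy over a short
time step, during which the chain moves to `σ (t + h)`. Almost every path has constant mode on some
right neighbourhood of `t`, so the difference quotients have a limit not exceeding the dissipation
`B`. They are only bounded above (as `f` is only one-sided Lipschitz), so dominated convergence is
applied to their maxima with `B`. -/
lemma eventually_integral_energy_increment_le (hf : QUAD G α 1 β f)
    (hs : ∀ t, 0 ≤ t → HasDerivWithinAt s (f (s t) t) (Set.Ici 0) t)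
    (hL : ∀ i, IsCoupling (L i)) (hσ : ∀ t, 0 ≤ t → Measurable (σ t))
    (hσr : ∀ᵐ ω ∂μ, ∀ t, 0 ≤ t → ∀ᶠ u in 𝓝[>] t, σ u ω = σ t ω)
    (hx : IsSolution μ f 1 κ ε L c s σ x) (hx0 : ∀ j, MemLp (fun ω => x 0 ω j) 2 μ)
    {C : ℝ} (hC0 : 0 ≤ C) (hC : ∀ i, 2 * lambdaMax (symPart (lyapMatrix α κ ε (L i) (c i) 1)) ≤ C)
    (hp : ∀ i k, 0 ≤ p i k)
    (hCp : ∀ i j, 2 * lambdaMax (symPart (lyapMatrix α κ ε (L i) (c i) (p j))) ≤ C)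
    {t : ℝ} (ht : 0 ≤ t) {η : ℝ} (hη : 0 < η) :
    ∀ᶠ h in 𝓝[>] (0 : ℝ),
      ∫ ω, errEnergy G s x (p (σ (t + h) ω)) (t + h) ω ∂μ
        - ∫ ω, errEnergy G s x (p (σ (t + h) ω)) t ω ∂μ ≤
      h * (∫ ω, dissipation G α β κ ε L c p s x (σ t ω) t ω ∂μ + η) := by
  have hone : ∀ u, 0 ≤ u → Integrable (errEnergy G s x 1 u) μ := fun u hu =>
    integrable_errEnergy_one hf hs hL hσ hx hx0 hC hu
  have hV : ∀ u, 0 ≤ u → ∀ j, Integrable (errEnergy G s x (p j) u) μ := fun u hu j =>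
    integrable_errEnergy hf.posDef hσ hx hu (hone u hu) (hp j)
  set B : Ω → ℝ := fun ω => dissipation G α β κ ε L c p s x (σ t ω) t ω with hBdef
  have hB : Integrable B μ := integrable_apply_mode
    (g := fun i ω => dissipation G α β κ ε L c p s x i t ω) (hσ t ht) fun i =>
      integrable_dissipation hf.posDef hσ hx ht (hone t ht) i
  set q : ℝ → Ω → ℝ := fun h ω =>
    h⁻¹ * (errEnergy G s x (p (σ (t + h) ω)) (t + h) ω - errEnergy G s x (p (σ (t + h) ω)) t ω)
    with hqdef
  have hi1 : ∀ h, 0 < h → Integrable (fun ω => errEnergy G s x (p (σ (t + h) ω)) (t + h) ω) μ :=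
    fun h hh => integrable_apply_mode (g := fun j ω => errEnergy G s x (p j) (t + h) ω)
      (hσ _ (by linarith)) (hV _ (by linarith))
  have hi2 : ∀ h, 0 < h → Integrable (fun ω => errEnergy G s x (p (σ (t + h) ω)) t ω) μ :=
    fun h hh => integrable_apply_mode (g := fun j ω => errEnergy G s x (p j) t ω)
      (hσ _ (by linarith)) (hV _ ht)
  have hq : ∀ h, 0 < h → Integrable (q h) μ := fun h hh =>
    ((hi1 h hh).sub (hi2 h hh)).const_mul h⁻¹
  have hlim : Tendsto (fun h => ∫ ω, max (q h ω) (B ω) ∂μ) (𝓝[>] 0) (𝓝 (∫ ω, B ω ∂μ)) := by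
    refine tendsto_integral_filter_of_dominated_convergence
      (fun ω => |B ω| + C * Real.exp (C * (t + 1)) * errEnergy G s x 1 0 ω) ?_ ?_ ?_ ?_
    · filter_upwards [self_mem_nhdsWithin] with h hh
      exact ((hq h hh).sup hB).aestronglyMeasurable
    · have h1 : ∀ᶠ h in 𝓝[>] (0 : ℝ), h < 1 :=
        (gt_mem_nhds one_pos).filter_mono nhdsWithin_le_nhds
      filter_upwards [self_mem_nhdsWithin, h1] with h hh hh1
      have hh : 0 < h := hh
      filter_upwards [hx.continuousOn, hx.equation] with ω hω1 hω2
      have hD : 0 ≤ C * Real.exp (C * (t + 1)) * errEnergy G s x 1 0 ω :=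
        mul_nonneg (mul_nonneg hC0 (Real.exp_pos _).le)
          (energy_nonneg hf.posDef (fun _ => zero_le_one) _)
      have hle := energy_sub_le (r := fun t => σ t ω) (x := fun t => x t ω) hf hs hL hω1 hω2 hC0 hC
        (hp (σ (t + h) ω)) (fun i => hCp i _) ht (by linarith : t ≤ t + h)
        (by linarith : t + h ≤ t + 1)
      have hqle : q h ω ≤ C * Real.exp (C * (t + 1)) * errEnergy G s x 1 0 ω := by
        simp only [hqdef]
        rw [inv_mul_le_iff₀ hh, mul_comm h]
        rw [add_sub_cancel_left] at hle
        exact hle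
      rw [Real.norm_eq_abs, abs_le]
      constructor
      · linarith [neg_abs_le (B ω), le_max_right (q h ω) (B ω)]
      · exact max_le (hqle.trans (by linarith [abs_nonneg (B ω)]))
          ((le_abs_self _).trans (by linarith))
    · exact hB.abs.add ((hone 0 le_rfl).const_mul _)
    · filter_upwards [hx.equation, hσr] with ω hω hωr
      obtain ⟨d, hd, hdB⟩ := exists_hasDerivWithinAt_energy_path (r := fun t => σ t ω)
        (x := fun t => x t ω) hf hs hL hω (hp (σ t ω)) ht
      have hdB : d ≤ B ω := hdB
      have h1 := (tendsto_inv_mul_sub_of_hasDerivWithinAt hd).max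
        (tendsto_const_nhds (x := B ω))
      rw [max_eq_right hdB] at h1
      refine h1.congr' ?_
      filter_upwards [(tendsto_add_left_nhdsGT t).eventually (hωr t ht)] with h hh
      simp only [hqdef, hh]
      rfl
  filter_upwards [self_mem_nhdsWithin, hlim.eventually_lt_const (lt_add_of_pos_right _ hη)]
    with h hh hlt
  have hh : 0 < h := hh
  have h1 : ∫ ω, q h ω ∂μ ≤ ∫ ω, max (q h ω) (B ω) ∂μ :=
    integral_mono (hq h hh) ((hq h hh).sup hB) fun ω => le_max_left _ _
  have h2 : ∫ ω, q h ω ∂μ = h⁻¹ * (∫ ω, errEnergy G s x (p (σ (t + h) ω)) (t + h) ω ∂μ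
        - ∫ ω, errEnergy G s x (p (σ (t + h) ω)) t ω ∂μ) := by
    rw [← integral_sub (hi1 h hh) (hi2 h hh), ← integral_const_mul]
  rw [h2, inv_mul_le_iff₀ hh] at h1
  exact h1.trans (mul_le_mul_of_nonneg_left hlt.le hh.le)

/-- Exponential decay of the expected energy `E V_{σ_t}(t)`. -/
theorem integral_errEnergy_le (hm : 0 < m) (hf : QUAD G α 1 β f)
    (hs : ∀ t, 0 ≤ t → HasDerivWithinAt s (f (s t) t) (Set.Ici 0) t)
    (hL : ∀ i, IsCoupling (L i)) {Q : Matrix (Fin N) (Fin N) ℝ} (hσ : IsMarkovChain μ Q σ)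
    (hx : IsSolution μ f 1 κ ε L c s σ x) (hind : IndepFun (x 0) (fun ω (t : ℝ≥0) => σ t ω) μ)
    (hx0 : ∀ j, MemLp (fun ω => x 0 ω j) 2 μ)
    {C : ℝ} (hC0 : 0 ≤ C) (hC : ∀ i, 2 * lambdaMax (symPart (lyapMatrix α κ ε (L i) (c i) 1)) ≤ C)
    (hp : ∀ i k, 0 < p i k)
    (hCp : ∀ i j, 2 * lambdaMax (symPart (lyapMatrix α κ ε (L i) (c i) (p j))) ≤ C)
    (hrate : ∀ i, -Q i i ≤
      -lambdaMax (symPart (lyapMatrix α κ ε (L i) (c i) (p i))) /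
        ⨆ j, lambdaMax (Matrix.diagonal (p j)))
    {g : ℝ} (hg : 0 < g) (hgle : ∀ (w : Fin m → ℝ), (∀ k, 0 ≤ w k) →
      ∀ e : Fin m → EuclideanSpace ℝ (Fin n), energy G w e ≤ g * ∑ k, w k * ‖e k‖ ^ 2)
    {t : ℝ} (ht : 0 ≤ t) :
    ∫ ω, errEnergy G s x (p (σ t ω)) t ω ∂μ ≤
      (∫ ω, errEnergy G s x (p (σ 0 ω)) 0 ω ∂μ) * Real.exp (-(2 * β / g) * t) := by
  obtain ⟨P, hP, hM⟩ := hσ.markov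
  have hσm := hσ.measurable
  have hp0 : ∀ i k, 0 ≤ p i k := fun i k => (hp i k).le
  have hone : ∀ u, 0 ≤ u → Integrable (errEnergy G s x 1 u) μ := fun u hu =>
    integrable_errEnergy_one hf hs hL hσm hx hx0 hC hu
  have hV : ∀ u, 0 ≤ u → ∀ j, Integrable (errEnergy G s x (p j) u) μ := fun u hu j =>
    integrable_errEnergy hf.posDef hσm hx hu (hone u hu) (hp0 j)
  set V : Fin N → ℝ → Ω → ℝ := fun j u ω => errEnergy G s x (p j) u ω with hVdef
  have hV0 : ∀ j u ω, 0 ≤ V j u ω := fun j u ω => energy_nonneg hf.posDef (hp0 j) _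
  set I : Fin N → Fin N → ℝ → ℝ := fun i j u => ∫ ω in σ u ⁻¹' {i}, V j u ω ∂μ with hIdef
  have hI0 : ∀ i j u, 0 ≤ I i j u := fun i j u => integral_nonneg fun ω => hV0 j u ω
  set φ : ℝ → ℝ := fun u => ∫ ω, V (σ u ω) u ω ∂μ with hφdef
  have hφ0 : 0 ≤ φ 0 := integral_nonneg fun ω => hV0 _ _ ω
  -- the expectation after a jump of the chain, with the nodes frozen at time `u`
  have hstep : ∀ u h, 0 ≤ u → 0 ≤ h →
      ∫ ω, V (σ (u + h) ω) u ω ∂μ = ∑ i, ∑ j, P h i j * I i j u := fun u h hu hh =>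
    integral_apply_mode_add (g := fun j ω => V j u ω) hx.measurable_init hσm hind hP.nonneg hM hu hh
      (fun j => aestronglyMeasurable_errEnergy (p j) (hx.adapted u hu)) (hV u hu)
  have hφI : ∀ u, 0 ≤ u → φ u = ∑ i, ∑ j, (1 : Matrix (Fin N) (Fin N) ℝ) i j * I i j u :=
    fun u hu => by
      have := hstep u 0 hu le_rfl
      rwa [add_zero, hP.zero] at this
  have hjump : ∀ u h, 0 ≤ u → 0 ≤ h → ∫ ω, V (σ (u + h) ω) u ω ∂μ - φ u =
      ∑ i, ∑ j, (P h i j - (1 : Matrix (Fin N) (Fin N) ℝ) i j) * I i j u := fun u h hu hh => by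
    rw [hstep u h hu hh, hφI u hu]
    simp only [sub_mul, Finset.sum_sub_distrib]
  refine le_mul_exp_of_forall_eventually (φ := φ) (div_nonneg (by linarith [hf.beta_pos]) hg.le)
    ?_ ?_ hφ0 ht
  · intro u hu η hη
    have hgen : Tendsto (fun h : ℝ => ∑ i, ∑ j,
        h⁻¹ * (P h i j - (1 : Matrix (Fin N) (Fin N) ℝ) i j) * I i j u) (𝓝[>] 0)
        (𝓝 (∑ i, ∑ j, Q i j * I i j u)) :=
      tendsto_finsetSum _ fun i _ => tendsto_finsetSum _ fun j _ =>
        (hP.tendsto_div i j).mul_const _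
    have hQI : ∫ ω, ∑ j, Q (σ u ω) j * V j u ω ∂μ = ∑ i, ∑ j, Q i j * I i j u := by
      rw [integral_apply_mode (g := fun i ω => ∑ j, Q i j * V j u ω) (hσm u hu) fun i =>
        integrable_finsetSum _ fun j _ => (hV u hu j).const_mul _]
      refine Finset.sum_congr rfl fun i _ => ?_
      rw [integral_finsetSum _ fun j _ => ((hV u hu j).const_mul _).restrict]
      exact Finset.sum_congr rfl fun j _ => integral_const_mul _ _
    have hLyap : ∫ ω, dissipation G α β κ ε L c p s x (σ u ω) u ω ∂μ + ∑ i, ∑ j, Q i j * I i j u ≤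
        -(2 * β / g) * φ u := by
      have i1 : Integrable (fun ω => dissipation G α β κ ε L c p s x (σ u ω) u ω) μ :=
        integrable_apply_mode (g := fun i ω => dissipation G α β κ ε L c p s x i u ω) (hσm u hu)
          fun i => integrable_dissipation hf.posDef hσm hx hu (hone u hu) i
      have i2 : Integrable (fun ω => ∑ j, Q (σ u ω) j * V j u ω) μ :=
        integrable_apply_mode (g := fun i ω => ∑ j, Q i j * V j u ω) (hσm u hu) fun i =>
          integrable_finsetSum _ fun j _ => (hV u hu j).const_mul _
      have i3 : Integrable (fun ω => V (σ u ω) u ω) μ :=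
        integrable_apply_mode (g := fun j ω => V j u ω) (hσm u hu) (hV u hu)
      rw [← hQI, ← integral_add i1 i2, hφdef, ← integral_const_mul]
      exact integral_mono (i1.add i2) (i3.const_mul _) fun ω =>
        dissipation_add_generator_le hf (fun i j hij => hP.generator_nonneg hij)
          hP.generator_row_sum hp hm hrate hg hgle (σ u ω) u ω
    filter_upwards [self_mem_nhdsWithin, hgen.eventually_lt_const
      (lt_add_of_pos_right _ (half_pos hη)), eventually_integral_energy_increment_le hf hs hL hσm
        hσ.right_cont hx hx0 hC0 hC hp0 hCp hu (half_pos hη)] with h hh h1 h2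
    have hh : 0 < h := hh
    have h3 := hjump u h hu hh.le
    have h4 : ∑ i, ∑ j, h⁻¹ * (P h i j - (1 : Matrix (Fin N) (Fin N) ℝ) i j) * I i j u =
        h⁻¹ * ∑ i, ∑ j, (P h i j - (1 : Matrix (Fin N) (Fin N) ℝ) i j) * I i j u := by
      simp only [Finset.mul_sum, mul_assoc]
    rw [h4, inv_mul_lt_iff₀ hh, ← h3] at h1
    have h5 := mul_le_mul_of_nonneg_left hLyap hh.le
    have h6 : φ (u + h) - ∫ ω, V (σ (u + h) ω) u ω ∂μ ≤
      h * (∫ ω, dissipation G α β κ ε L c p s x (σ u ω) u ω ∂μ + η / 2) := h2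
    linarith
  · intro u hu η hη
    -- upward jumps are excluded by the one-sided Lipschitz bound and `P h → 1`, with constants that
    -- are uniform on `[0, u]`
    set E0 := ∫ ω, errEnergy G s x 1 0 ω ∂μ with hE0
    set K := Real.exp (C * u) * E0
    have hIK : ∀ v, 0 ≤ v → v ≤ u → ∀ i j, I i j v ≤ (∑ k, p j k) * K := by
      intro v hv hvu i j
      have h1 : I i j v ≤ ∫ ω, V j v ω ∂μ :=
        setIntegral_le_integral (hV v hv j) (Eventually.of_forall fun ω => hV0 j v ω)
      refine h1.trans ?_
      have hK : (∑ k, p j k) * K =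
          ∫ ω, (∑ k, p j k) * (Real.exp (C * u) * errEnergy G s x 1 0 ω) ∂μ := by
        rw [integral_const_mul, integral_const_mul]
      rw [hK]
      refine integral_mono_ae (hV v hv j) (((hone 0 le_rfl).const_mul _).const_mul _) ?_
      filter_upwards [ae_errEnergy_one_le hf hs hL hx hC hv] with ω hω
      have e1 : V j v ω ≤ (∑ k, p j k) * errEnergy G s x 1 v ω := energy_le_mul_energy_one hf.posDef
        (fun k => Finset.single_le_sum (fun k _ => hp0 j k) (Finset.mem_univ k)) _
      have e2 : Real.exp (C * v) ≤ Real.exp (C * u) :=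
        Real.exp_le_exp.2 (mul_le_mul_of_nonneg_left hvu hC0)
      refine e1.trans (mul_le_mul_of_nonneg_left (hω.trans ?_)
        (Finset.sum_nonneg fun k _ => hp0 j k))
      exact mul_le_mul_of_nonneg_right e2 (energy_nonneg hf.posDef (fun _ => zero_le_one) _)
    have hinc : ∀ v, 0 ≤ v → v ≤ u →
        φ u - ∫ ω, V (σ u ω) v ω ∂μ ≤ C * Real.exp (C * u) * E0 * (u - v) := by
      intro v hv hvu
      have i1 : Integrable (fun ω => V (σ u ω) u ω) μ :=
        integrable_apply_mode (g := fun j ω => V j u ω) (hσm u hu.le) (hV u hu.le)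
      have i2 : Integrable (fun ω => V (σ u ω) v ω) μ :=
        integrable_apply_mode (g := fun j ω => V j v ω) (hσm u hu.le) (hV v hv)
      rw [hφdef, ← integral_sub i1 i2, ← integral_const_mul, ← integral_mul_const]
      refine integral_mono_ae (i1.sub i2) (((hone 0 le_rfl).const_mul _).mul_const _) ?_
      filter_upwards [hx.continuousOn, hx.equation] with ω hω1 hω2
      exact energy_sub_le (r := fun t => σ t ω) (x := fun t => x t ω) hf hs hL hω1 hω2 hC0 hC
        (hp0 (σ u ω)) (fun i => hCp i _) hv hvu le_rfl
    have hlim : Tendsto (fun h : ℝ => C * Real.exp (C * u) * E0 * h + ∑ i, ∑ j,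
        |P h i j - (1 : Matrix (Fin N) (Fin N) ℝ) i j| * ((∑ k, p j k) * K)) (𝓝[>] 0) (𝓝 0) := by
      have h1 : Tendsto (fun h : ℝ => C * Real.exp (C * u) * E0 * h) (𝓝[>] 0) (𝓝 0) := by
        have := (tendsto_id.mono_left nhdsWithin_le_nhds :
          Tendsto (fun h : ℝ => h) (𝓝[>] 0) (𝓝 0)).const_mul (C * Real.exp (C * u) * E0)
        rwa [mul_zero] at this
      have h2 : Tendsto (fun h : ℝ => ∑ i, ∑ j,
          |P h i j - (1 : Matrix (Fin N) (Fin N) ℝ) i j| * ((∑ k, p j k) * K)) (𝓝[>] 0)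
          (𝓝 (∑ i : Fin N, ∑ j : Fin N, |(0 : ℝ)| * ((∑ k, p j k) * K))) :=
        tendsto_finsetSum _ fun i _ => tendsto_finsetSum _ fun j _ =>
          (hP.tendsto_sub i j).abs.mul_const _
      simpa using h1.add h2
    have hsub : Tendsto (fun v : ℝ => u - v) (𝓝[<] u) (𝓝[>] 0) := by
      refine tendsto_nhdsWithin_iff.2 ⟨?_, ?_⟩
      · have : Tendsto (fun v : ℝ => u - v) (𝓝 u) (𝓝 (u - u)) :=
          (continuous_const.sub continuous_id).tendsto u
        rw [sub_self] at this
        exact this.mono_left nhdsWithin_le_nhds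
      · filter_upwards [self_mem_nhdsWithin] with v hv
        exact sub_pos.2 (Set.mem_Iio.1 hv)
    have e1 : ∀ᶠ v in 𝓝[<] u, 0 < v := (lt_mem_nhds hu).filter_mono nhdsWithin_le_nhds
    filter_upwards [hsub.eventually (hlim.eventually_lt_const hη), e1, self_mem_nhdsWithin]
      with v h1 hv hvu
    have hvu : v ≤ u := le_of_lt hvu
    have h2 := hjump v (u - v) hv.le (by linarith)
    rw [add_sub_cancel] at h2
    have h3 : ∑ i, ∑ j, (P (u - v) i j - (1 : Matrix (Fin N) (Fin N) ℝ) i j) * I i j v ≤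
        ∑ i, ∑ j, |P (u - v) i j - (1 : Matrix (Fin N) (Fin N) ℝ) i j| * ((∑ k, p j k) * K) :=
      Finset.sum_le_sum fun i _ => Finset.sum_le_sum fun j _ =>
        (mul_le_mul_of_nonneg_right (le_abs_self _) (hI0 i j v)).trans
          (mul_le_mul_of_nonneg_left (hIK v hv.le hvu i j) (abs_nonneg _))
    linarith [hinc v hv.le hvu]

/-- The mean-square stability criterion: the expected energy decays, and it dominates
`E ‖x_j - s‖²` since `G` is positive definite and the weights are bounded below. -/
theorem meanSquareExpStable (hm : 0 < m) (hN : 0 < N) (hf : QUAD G α 1 β f)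
    (hs : ∀ t, 0 ≤ t → HasDerivWithinAt s (f (s t) t) (Set.Ici 0) t)
    (hL : ∀ i, IsCoupling (L i)) {Q : Matrix (Fin N) (Fin N) ℝ} (hσ : IsMarkovChain μ Q σ)
    (hp : ∀ i k, 0 < p i k)
    (hrate : ∀ i, -Q i i ≤
      -lambdaMax (symPart (lyapMatrix α κ ε (L i) (c i) (p i))) /
        ⨆ j, lambdaMax (Matrix.diagonal (p j))) :
    MeanSquareExpStable μ f 1 κ ε L c s σ := by
  obtain ⟨g, hg, hgle⟩ := exists_energy_le (m := m) hf.posDef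
  obtain ⟨g₀, hg₀, hg₀le⟩ := exists_le_energy (m := m) hf.posDef
  have hne : Nonempty (Fin N × Fin m) := ⟨⟨0, hN⟩, ⟨0, hm⟩⟩
  obtain ⟨ik, hik⟩ := Finite.exists_min fun ik : Fin N × Fin m => p ik.1 ik.2
  set b := p ik.1 ik.2
  have hb : 0 < b := hp _ _
  obtain ⟨C, hC0, hC, hCp⟩ : ∃ C : ℝ, 0 ≤ C ∧
      (∀ i, 2 * lambdaMax (symPart (lyapMatrix α κ ε (L i) (c i) 1)) ≤ C) ∧
      ∀ i j, 2 * lambdaMax (symPart (lyapMatrix α κ ε (L i) (c i) (p j))) ≤ C := by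
    obtain ⟨C₁, h₁⟩ := (Set.finite_range fun i =>
      2 * lambdaMax (symPart (lyapMatrix α κ ε (L i) (c i) 1))).bddAbove
    obtain ⟨C₂, h₂⟩ := (Set.finite_range fun ij : Fin N × Fin N =>
      2 * lambdaMax (symPart (lyapMatrix α κ ε (L ij.1) (c ij.1) (p ij.2)))).bddAbove
    exact ⟨max 0 (max C₁ C₂), le_max_left _ _,
      fun i => (h₁ ⟨i, rfl⟩).trans ((le_max_left _ _).trans (le_max_right _ _)),
      fun i j => (h₂ ⟨(i, j), rfl⟩).trans ((le_max_right _ _).trans (le_max_right _ _))⟩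
  refine ⟨2 * β / g, div_pos (by linarith [hf.beta_pos]) hg, fun x hx hind hx0 => ?_⟩
  have hone : ∀ u, 0 ≤ u → Integrable (errEnergy G s x 1 u) μ := fun u hu =>
    integrable_errEnergy_one hf hs hL hσ.measurable hx hx0 hC hu
  set φ₀ := ∫ ω, errEnergy G s x (p (σ 0 ω)) 0 ω ∂μ with hφ₀
  have hφ₀0 : 0 ≤ φ₀ :=
    integral_nonneg fun ω => energy_nonneg hf.posDef (fun k => (hp (σ 0 ω) k).le) _
  refine ⟨φ₀ / (g₀ * b) + 1, by positivity, fun t ht j => ?_⟩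
  have hint := integrable_norm_sq_error hf.posDef hσ.measurable hx ht.le (hone t ht.le) j
  refine ⟨hint, ?_⟩
  have hdec := integral_errEnergy_le hm hf hs hL hσ hx hind hx0 hC0 hC hp hCp hrate hg hgle ht.le
  have hle : (g₀ * b) * ∫ ω, ‖x t ω j - s t‖ ^ 2 ∂μ ≤
      ∫ ω, errEnergy G s x (p (σ t ω)) t ω ∂μ := by
    rw [← integral_const_mul]
    refine integral_mono (hint.const_mul _) (integrable_apply_mode
      (g := fun i ω => errEnergy G s x (p i) t ω) (hσ.measurable t ht.le) fun i =>
        integrable_errEnergy hf.posDef hσ.measurable hx ht.le (hone t ht.le) fun k => (hp i k).le)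
      fun ω => ?_
    have h1 := mul_le_mul_of_nonneg_left (hg₀le (fun k => x t ω k - s t) j) hb.le
    have h2 := mul_energy_one_le_energy hf.posDef (fun k => hik (σ t ω, k)) (fun k => x t ω k - s t)
    simp only [errEnergy]
    linarith
  have hgb : 0 < g₀ * b := mul_pos hg₀ hb
  have h3 : ∫ ω, ‖x t ω j - s t‖ ^ 2 ∂μ ≤ φ₀ / (g₀ * b) * Real.exp (-(2 * β / g) * t) := by
    rw [div_mul_eq_mul_div, le_div_iff₀ hgb, mul_comm _ (g₀ * b)]
    exact hle.trans hdec
  linarith [Real.exp_pos (-(2 * β / g) * t)]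

end MeanSquare

end Pinning

theorem theorem2 {m n N : ℕ} (hm : 0 < m) (hN : 0 < N)
    -- the node dynamics and the target trajectory
    (f : EuclideanSpace ℝ (Fin n) → ℝ → EuclideanSpace ℝ (Fin n))
    (G : Matrix (Fin n) (Fin n) ℝ) (α β : ℝ) (hf : Pinning.QUAD G α 1 β f)
    (s : ℝ → EuclideanSpace ℝ (Fin n))
    (hs : ∀ t, 0 ≤ t → HasDerivWithinAt s (f (s t) t) (Set.Ici 0) t)
    -- the coupling matrices and the controller-node sets
    (L : Fin N → Matrix (Fin m) (Fin m) ℝ) (hL : ∀ i, Pinning.IsCoupling (L i))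
    (hLconn : ∀ i, Pinning.StronglyConnected (L i))
    (c : Fin N → Fin m → ℝ) (hc : ∀ i j, c i j = 0 ∨ c i j = 1)
    (hcne : 0 ≤ α → ∀ i, ∃ j, c i j = 1)
    -- the switching chain
    {Ω : Type*} [MeasurableSpace Ω] (μ : Measure Ω) [IsProbabilityMeasure μ]
    (Q : Matrix (Fin N) (Fin N) ℝ) (σ : ℝ → Ω → Fin N) (hσ : Pinning.IsMarkovChain μ Q σ) :
    (∃ p : Fin N → Fin m → ℝ, (∀ i j, 0 < p i j) ∧ (∀ i, p i ᵥ* L i = 0) ∧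
      ∃ κ ε : ℝ, 0 < κ ∧ 0 < ε ∧
        ∀ i, Pinning.NegDef (Pinning.symPart (Pinning.lyapMatrix α κ ε (L i) (c i) (p i)))) ∧
    (∀ (p : Fin N → Fin m → ℝ) (κ ε : ℝ), (∀ i j, 0 < p i j) → 0 < κ → 0 < ε →
      (∀ i, Pinning.NegDef (Pinning.symPart (Pinning.lyapMatrix α κ ε (L i) (c i) (p i)))) →
      (∀ i, -Q i i ≤
        -Pinning.lambdaMax (Pinning.symPart (Pinning.lyapMatrix α κ ε (L i) (c i) (p i))) /
          ⨆ j, Pinning.lambdaMax (Matrix.diagonal (p j))) →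
      Pinning.MeanSquareExpStable μ f 1 κ ε L c s σ) := by
  refine ⟨Pinning.exists_negDef_lyapMatrix hm α L hL hLconn c hc hcne, ?_⟩
  intro p κ ε hp _ _ _ hrate
  exact Pinning.meanSquareExpStable hm hN hf hs hL hσ hp hrate
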